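/- For $d\ge 1$, $0<p\le\infty$ and $\sigma>0$ let $\mathsf B_p^d=\{\theta\in\mathbb R^d:\|\theta\|_p\le 1\}$, where $\|\theta\|_p=(\sum_{i}|\theta_i|^p)^{1/p}$ for $p<\infty$ and $\|\theta\|_\infty=\max_i|\theta_i|$, and for $1\le s\le d$ let $\mathsf B_0^d(s)$ be the set of $\theta\in\mathbb R^d$ with at most $s$ nonzero entries. For $\Theta\subset\mathbb R^d$ let $$\mathcal M(\Theta,\sigma)=\inf_{\hat\theta}\ \sup_{\theta\in\Theta}\ \mathbf E_{Y\sim N(\theta,\sigma^2I_d)}\|\hat\theta(Y)-\theta\|_2^2$$ be the minimax risk, the infimum being over all measurable $\hat\theta:\mathbb R^d\to\mathbb R^d$, and let $$\mathcal R^{\mathsf{MLE}}(\Theta,\sigma)=\sup_{\theta\in\Theta}\ \mathbf E_{Y\sim N(\theta,\sigma^2I_d)}\|\Pi_\Theta(Y)-\theta\|_2^2,\qquad \Pi_\Theta(y)\in\operatorname*{arg\,min}_{\vartheta\in\Theta}\|\vartheta-y\|_2^2,$$ be the worst-case risk of the maximum likelihood estimator, the Euclidean projection onto $\Theta$ (almost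 surely unique for the sets below; ties may be broken arbitrarily). There is a universal constant $C$ (depending on none of $p,d,\sigma,s$) such that $$1\le \frac{\mathcal R^{\mathsf{MLE}}(\Theta,\sigma)}{\mathcal M(\Theta,\sigma)}\le C$$ in each of the following cases: 1. $\Theta=\mathsf B_p^d$ with $2\le p\le\infty$, for all $d\ge1$ and $\sigma>0$; 2. $\Theta=\mathsf B_p^d$ with $d\ge 1$ and $0<p\le 1+\frac1{1+\log d}$, for all $\sigma>0$; 3. $\Theta=\mathsf B_p^d$ with $d\ge 1$ and $1+\frac1{1+\log d}<p<2$, for all $\sigma>0$ with $\sigma\le d^{-1/p}$ or $\sigma\ge(1+\log d)^{-1/2}$; 4. $\Theta=\mathsf B_0^d(s)$, for all $d\ge1$, $1\le s\le d$ and $\sigma>0$. -/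

import Mathlib

open MeasureTheory ProbabilityTheory
open scoped NNReal ENNReal

namespace GaussianSequence

/-- The unit `ℓ_p` ball of `ℝ^d`, for `0 < p ≤ ∞`. The (quasi)norm is the one of Mathlib's `PiLp`:
`(∑ i, |θ i| ^ p) ^ (1 / p)` for every `0 < p < ∞`, and `max_i |θ i|` for `p = ∞`. -/
def lpBall (d : ℕ) (p : ℝ≥0∞) : Set (EuclideanSpace ℝ (Fin d)) :=
  {θ | ‖(WithLp.toLp p θ.ofLp : PiLp p fun _ : Fin d => ℝ)‖ ≤ 1}

/-- The set of vectors of `ℝ^d` with at most `s` nonzero entries. -/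
def sparseBall (d s : ℕ) : Set (EuclideanSpace ℝ (Fin d)) :=
  {θ | (Finset.univ.filter fun i => θ i ≠ 0).card ≤ s}

/-- The law `N(θ, σ² I_d)` of the observation. -/
noncomputable def gaussianLaw {d : ℕ} (θ : EuclideanSpace ℝ (Fin d)) (σ : ℝ) :
    Measure (EuclideanSpace ℝ (Fin d)) :=
  multivariateGaussian θ (σ ^ 2 • (1 : Matrix (Fin d) (Fin d) ℝ))

/-- The worst-case mean squared error over `Θ` of the estimator `est`, with values in `[0, ∞]`. -/
noncomputable def worstCaseRisk {d : ℕ} (Θ : Set (EuclideanSpace ℝ (Fin d))) (σ : ℝ)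
    (est : EuclideanSpace ℝ (Fin d) → EuclideanSpace ℝ (Fin d)) : ℝ≥0∞ :=
  ⨆ θ ∈ Θ, ∫⁻ y, ENNReal.ofReal (‖est y - θ‖ ^ 2) ∂(gaussianLaw θ σ)

/-- The minimax risk: the infimum over all measurable estimators of the worst-case risk. -/
noncomputable def minimaxRisk {d : ℕ} (Θ : Set (EuclideanSpace ℝ (Fin d))) (σ : ℝ) : ℝ≥0∞ :=
  ⨅ (est : EuclideanSpace ℝ (Fin d) → EuclideanSpace ℝ (Fin d)) (_ : Measurable est),
    worstCaseRisk Θ σ est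

/-- `proj` is a Euclidean projection onto `Θ` (a version of the MLE): for every `y`, the point `proj y`
minimizes `ϑ ↦ ‖ϑ - y‖²` over `Θ`. Two such maps agree Lebesgue-almost everywhere (a nearest point
is unique wherever the distance to `Θ` is differentiable), so each of them is almost everywhere
equal to a measurable map and its risk does not depend on how ties are broken. -/
def IsProjection {d : ℕ} (Θ : Set (EuclideanSpace ℝ (Fin d)))
    (proj : EuclideanSpace ℝ (Fin d) → EuclideanSpace ℝ (Fin d)) : Prop :=
  ∀ y, proj y ∈ Θ ∧ ∀ ϑ ∈ Θ, ‖proj y - y‖ ^ 2 ≤ ‖ϑ - y‖ ^ 2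

/-- The ratio of the worst-case risk of `est` to the minimax risk. -/
noncomputable def competitiveRatio {d : ℕ} (Θ : Set (EuclideanSpace ℝ (Fin d))) (σ : ℝ)
    (est : EuclideanSpace ℝ (Fin d) → EuclideanSpace ℝ (Fin d)) : ℝ≥0∞ :=
  worstCaseRisk Θ σ est / minimaxRisk Θ σ

/-- The competitive ratio of the MLE over `Θ` at noise level `σ` lies in `[1, C]`. -/
def MLEOrderOptimal (C : ℝ≥0) {d : ℕ} (Θ : Set (EuclideanSpace ℝ (Fin d))) (σ : ℝ) : Prop :=
  ∀ proj : EuclideanSpace ℝ (Fin d) → EuclideanSpace ℝ (Fin d), IsProjection Θ proj →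
    1 ≤ competitiveRatio Θ σ proj ∧ competitiveRatio Θ σ proj ≤ C

/-- A projection onto a nonempty closed set exists. -/
theorem exists_isProjection {d : ℕ} {Θ : Set (EuclideanSpace ℝ (Fin d))} (hc : IsClosed Θ)
    (hne : Θ.Nonempty) : ∃ proj, IsProjection Θ proj := by
  choose proj hP using fun y => hc.exists_infDist_eq_dist hne y
  refine ⟨proj, fun y => ⟨(hP y).1, fun ϑ hϑ => ?_⟩⟩
  have h := Metric.infDist_le_dist_of_mem (x := y) hϑ
  rw [(hP y).2, dist_comm, dist_comm y, dist_eq_norm, dist_eq_norm] at h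
  gcongr

/-- The MLE over each `ℓ_p` ball exists. -/
theorem exists_isProjection_lpBall (d : ℕ) {p : ℝ≥0∞} (hp : p ≠ 0) :
    ∃ proj, IsProjection (lpBall d p) proj := by
  refine exists_isProjection ?_ ⟨0, ?_⟩
  · rcases eq_or_ne p ∞ with rfl | hp'
    · exact isClosed_le (by fun_prop) continuous_const
    · have h0 : 0 < p.toReal := ENNReal.toReal_pos hp hp'
      simp only [lpBall, PiLp.norm_eq_sum h0]
      refine isClosed_le (Continuous.rpow_const ?_ fun _ => Or.inr (by positivity))
        continuous_const
      exact continuous_finsetSum _ fun i _ =>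
        Continuous.rpow_const (by fun_prop) fun _ => Or.inr h0.le
  · rcases eq_or_ne p ∞ with rfl | hp'
    · simp [lpBall]
    · have h0 : 0 < p.toReal := ENNReal.toReal_pos hp hp'
      simp [lpBall, PiLp.norm_eq_sum h0, Real.zero_rpow h0.ne', Real.zero_rpow (inv_ne_zero h0.ne')]

/-- The MLE over each set of sparse vectors exists. -/
theorem exists_isProjection_sparseBall (d s : ℕ) : ∃ proj, IsProjection (sparseBall d s) proj := by
  refine exists_isProjection ?_ ⟨0, by simp [sparseBall]⟩
  have h : sparseBall d s = ⋃ S ∈ (Finset.univ.filter fun S : Finset (Fin d) => S.card ≤ s),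
      ⋂ i ∈ Sᶜ, {θ : EuclideanSpace ℝ (Fin d) | θ i = 0} := by
    ext θ
    simp only [sparseBall, Set.mem_ofPred_eq, Set.mem_iUnion, Set.mem_iInter, Finset.mem_filter,
      Finset.mem_univ, true_and, Finset.mem_compl, exists_prop]
    constructor
    · exact fun hθ => ⟨_, hθ, fun i hi => by simpa using hi⟩
    · rintro ⟨S, hS, hi⟩
      refine (Finset.card_le_card fun i h => ?_).trans hS
      by_contra h'
      exact (Finset.mem_filter.mp h).2 (hi i h')
  rw [h]
  refine isClosed_biUnion_finset fun S _ => isClosed_biInter fun i _ => ?_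
  exact isClosed_eq (by fun_prop) continuous_const

end GaussianSequence

open GaussianSequence

/-! Upper and lower bounds of the same order are matched in each regime. That the ratio is at least
1 needs only that the projection agrees almost everywhere with a measurable map.

Upper bound (`IsProjection.worstCaseRisk_le`). With v = proj y, minimality against θ gives ‖v - θ‖²
≤ 2⟨y - θ, v - θ⟩. Each noise coordinate is split at a level τ. The part below τ contributes at most
2τ‖v - θ‖₁, which the geometry of Θ absorbs: v - θ has few nonzero entries, or a bounded ℓ_q sum
with q ≤ 1. The excess over τ has second moment exponentially small in (τ/σ)². The crude bounds dσ²
and squared radius cover the remaining regimes.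

Lower bound (`le_minimaxRisk`). Put at most one spike of height a, of order σ√log(1 + m), in each of
n disjoint blocks of m coordinates. No estimator locates the spikes reliably, so each block costs
order a².

The resulting orders are dσ² when Θ contains the cube |θ_i| ≤ σ; d^(1-2/p) for p ≥ 2 and larger σ;
sσ²(1 + log(d/s)) for sparse vectors; for q ≤ 1, ρ^(2-q) with ρ = σ√(1 + log(dσ^q)), once dσ^q ≥ 1
and while ρ ≤ 1; and 1 for large noise when p < 2. For 1 ≤ p ≤ 1 + 1/(1 + log d) the ball lies
between the ℓ_1 balls of radii 1 and 3, so q = 1 applies. -/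

namespace GaussianSequence
open scoped RealInnerProductSpace

/-! ### The Gaussian law: density and comparison of shifts -/

theorem posSemidef_sq_smul_one (d : ℕ) (σ : ℝ) :
    (σ ^ 2 • (1 : Matrix (Fin d) (Fin d) ℝ)).PosSemidef :=
  Matrix.PosSemidef.one.smul (sq_nonneg σ)

instance {d : ℕ} (θ : EuclideanSpace ℝ (Fin d)) (σ : ℝ) : IsProbabilityMeasure (gaussianLaw θ σ) := by
  unfold gaussianLaw; infer_instance

theorem charFun_gaussianLaw {d : ℕ} (θ t : EuclideanSpace ℝ (Fin d)) (σ : ℝ) :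
    charFun (gaussianLaw θ σ) t =
      Complex.exp (⟪t, θ⟫ * Complex.I - (σ ^ 2 * ‖t‖ ^ 2 / 2 : ℝ)) := by
  rw [gaussianLaw, charFun_multivariateGaussian (posSemidef_sq_smul_one d σ)]
  congr 2
  rw [EuclideanSpace.real_norm_sq_eq]
  simp only [Matrix.smul_mulVec, Matrix.one_mulVec, dotProduct, Finset.mul_sum]
  push_cast
  congr 1
  exact Finset.sum_congr rfl fun i _ => by simp only [Pi.smul_apply, smul_eq_mul]; push_cast; ring

theorem map_eval_gaussianLaw {d : ℕ} (θ : EuclideanSpace ℝ (Fin d)) (σ : ℝ) (i : Fin d) :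
    MeasurePreserving (fun y : EuclideanSpace ℝ (Fin d) => y i) (gaussianLaw θ σ)
      (gaussianReal (θ i) (σ ^ 2).toNNReal) := by
  have := measurePreserving_eval_multivariateGaussian (μ := θ) (posSemidef_sq_smul_one d σ) (i := i)
  simpa [gaussianLaw] using this

/-- The Lebesgue density of `N(θ, σ² I_d)`. -/
noncomputable def gaussianDensity {d : ℕ} (θ : EuclideanSpace ℝ (Fin d)) (σ : ℝ)
    (y : EuclideanSpace ℝ (Fin d)) : ℝ :=
  (∫ x : EuclideanSpace ℝ (Fin d), Real.exp (-(2 * σ ^ 2)⁻¹ * ‖x‖ ^ 2))⁻¹ *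
    Real.exp (-(2 * σ ^ 2)⁻¹ * ‖y - θ‖ ^ 2)

theorem gaussianDensity_nonneg {d : ℕ} (θ y : EuclideanSpace ℝ (Fin d)) (σ : ℝ) :
    0 ≤ gaussianDensity θ σ y :=
  mul_nonneg (inv_nonneg.2 (integral_nonneg fun _ => (Real.exp_pos _).le)) (Real.exp_pos _).le

theorem continuous_gaussianDensity {d : ℕ} (θ : EuclideanSpace ℝ (Fin d)) (σ : ℝ) :
    Continuous (gaussianDensity θ σ) := by
  unfold gaussianDensity; fun_prop

theorem gaussianDensity_integrable {d : ℕ} (θ : EuclideanSpace ℝ (Fin d)) {σ : ℝ} (hσ : 0 < σ) :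
    Integrable (gaussianDensity θ σ) := by
  have hb : 0 < (2 * σ ^ 2)⁻¹ := by positivity
  have h := GaussianFourier.integrable_cexp_neg_mul_sq_norm_add (V := EuclideanSpace ℝ (Fin d))
    (b := ((2 * σ ^ 2)⁻¹ : ℝ)) (by rw [Complex.ofReal_re]; exact hb) 0 0
  have h2 := h.re
  refine Integrable.const_mul (Integrable.comp_sub_right (f := fun y => Real.exp (-(2 * σ ^ 2)⁻¹ * ‖y‖ ^ 2)) ?_ θ) _
  refine h2.congr (Filter.Eventually.of_forall fun x => ?_)
  simp only [zero_mul, add_zero]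
  have : -(((2 * σ ^ 2)⁻¹ : ℝ) : ℂ) * (‖x‖ : ℂ) ^ 2 = ((-(2 * σ ^ 2)⁻¹ * ‖x‖ ^ 2 : ℝ) : ℂ) := by
    push_cast; ring
  rw [this, ← Complex.ofReal_exp]
  exact Complex.ofReal_re _

/-- Both are finite measures, so equality of characteristic functions suffices; the right-hand one
is the Fourier transform of the Gaussian kernel. -/
theorem gaussianLaw_eq_withDensity {d : ℕ} (θ : EuclideanSpace ℝ (Fin d)) {σ : ℝ} (hσ : 0 < σ) :
    gaussianLaw θ σ = volume.withDensity fun y => ENNReal.ofReal (gaussianDensity θ σ y) := by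
  have hb : 0 < (2 * σ ^ 2)⁻¹ := by positivity
  have hint := gaussianDensity_integrable θ hσ
  have : IsFiniteMeasure (volume.withDensity fun y => ENNReal.ofReal (gaussianDensity θ σ y)) :=
    isFiniteMeasure_withDensity_ofReal hint.2
  refine Measure.ext_of_charFun (funext fun t => ?_)
  rw [charFun_gaussianLaw, charFun_apply,
    integral_withDensity_eq_integral_toReal_smul (by
      exact (continuous_gaussianDensity θ σ).measurable.ennreal_ofReal) (by simp)]
  rw [← integral_add_right_eq_self _ θ]
  set I₀ := ∫ x : EuclideanSpace ℝ (Fin d), Real.exp (-(2 * σ ^ 2)⁻¹ * ‖x‖ ^ 2) with hI₀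
  have hI : (I₀ : ℂ) = ∫ x : EuclideanSpace ℝ (Fin d), Complex.exp (-((2 * σ ^ 2)⁻¹ : ℝ) * ‖x‖ ^ 2) := by
    rw [hI₀, ← integral_complex_ofReal]
    congr 1; ext x; push_cast; rfl
  have hI2 := GaussianFourier.integral_cexp_neg_mul_sq_norm (V := EuclideanSpace ℝ (Fin d))
    (b := ((2 * σ ^ 2)⁻¹ : ℝ)) (by rw [Complex.ofReal_re]; exact hb)
  have hI3 := GaussianFourier.integral_cexp_neg_mul_sq_norm_add (V := EuclideanSpace ℝ (Fin d))
    (b := ((2 * σ ^ 2)⁻¹ : ℝ)) (by rw [Complex.ofReal_re]; exact hb) Complex.I t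
  have hpos : I₀ ≠ 0 := by
    rw [hI₀, GaussianFourier.integral_rexp_neg_mul_sq_norm hb]
    positivity
  have key : ∀ x : EuclideanSpace ℝ (Fin d),
      (ENNReal.ofReal (gaussianDensity θ σ (x + θ))).toReal • Complex.exp (⟪x + θ, t⟫ * Complex.I) =
      ((I₀ : ℂ)⁻¹ * Complex.exp (⟪t, θ⟫ * Complex.I)) *
        Complex.exp (-((2 * σ ^ 2)⁻¹ : ℝ) * ‖x‖ ^ 2 + Complex.I * ⟪t, x⟫) := by
    intro x
    rw [ENNReal.toReal_ofReal (gaussianDensity_nonneg _ _ _), gaussianDensity, add_sub_cancel_right,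
      Complex.real_smul, inner_add_left, real_inner_comm, real_inner_comm t θ]
    push_cast
    rw [← hI₀, mul_assoc, mul_assoc, ← Complex.exp_add, ← Complex.exp_add]
    congr 2
    ring
  simp_rw [key]
  rw [integral_const_mul, hI3, ← hI2, ← hI, Complex.exp_sub]
  have hpos' : (I₀ : ℂ) ≠ 0 := by exact_mod_cast hpos
  have e1 : Complex.exp (Complex.I ^ 2 * ‖t‖ ^ 2 / (4 * ((2 * σ ^ 2)⁻¹ : ℝ))) =
      (Complex.exp ((σ ^ 2 * ‖t‖ ^ 2 / 2 : ℝ)))⁻¹ := by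
    rw [← Complex.exp_neg]
    congr 1
    have : (σ : ℂ) ≠ 0 := by exact_mod_cast hσ.ne'
    push_cast
    rw [Complex.I_sq]
    field_simp
    ring
  rw [e1]
  field_simp

theorem gaussianLaw_absolutelyContinuous {d : ℕ} (θ : EuclideanSpace ℝ (Fin d)) {σ : ℝ} (hσ : 0 < σ) :
    gaussianLaw θ σ ≪ volume := by
  rw [gaussianLaw_eq_withDensity θ hσ]
  exact withDensity_absolutelyContinuous _ _

/-- By the parallelogram law the density at the midpoint θ + u is exp(‖u‖²/(2σ²)) times the
geometric mean of the densities at θ and θ + 2u. Weighted AM-GM then makes the bound linear in both.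
-/
theorem gaussianDensity_add_le {d : ℕ} (θ u y : EuclideanSpace ℝ (Fin d)) {σ l : ℝ} (hl : 0 < l) :
    gaussianDensity (θ + u) σ y ≤ Real.exp (‖u‖ ^ 2 / (2 * σ ^ 2)) / 2 *
      (l * gaussianDensity θ σ y + l⁻¹ * gaussianDensity (θ + (2 : ℝ) • u) σ y) := by
  have hc : 0 ≤ (∫ x : EuclideanSpace ℝ (Fin d), Real.exp (-(2 * σ ^ 2)⁻¹ * ‖x‖ ^ 2))⁻¹ :=
    inv_nonneg.2 (integral_nonneg fun _ => (Real.exp_pos _).le)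
  unfold gaussianDensity
  set c := (∫ x : EuclideanSpace ℝ (Fin d), Real.exp (-(2 * σ ^ 2)⁻¹ * ‖x‖ ^ 2))⁻¹
  set b := (2 * σ ^ 2)⁻¹ with hb
  obtain ⟨w, hw⟩ : ∃ w, w = y - θ := ⟨_, rfl⟩
  have h1 : y - (θ + u) = w - u := by rw [hw]; abel
  have h2 : y - (θ + (2 : ℝ) • u) = w - (2 : ℝ) • u := by rw [hw]; abel
  rw [h1, h2, ← hw]
  set f := Real.exp (-b * ‖w‖ ^ 2 / 2)
  set g := Real.exp (-b * ‖w - (2 : ℝ) • u‖ ^ 2 / 2)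
  have e1 : Real.exp (-b * ‖w‖ ^ 2) = f ^ 2 := by rw [← Real.exp_nat_mul]; congr 1; push_cast; ring
  have e2 : Real.exp (-b * ‖w - (2 : ℝ) • u‖ ^ 2) = g ^ 2 := by
    rw [← Real.exp_nat_mul]; congr 1; push_cast; ring
  have e3 : Real.exp (-b * ‖w - u‖ ^ 2) = Real.exp (‖u‖ ^ 2 / (2 * σ ^ 2)) * (f * g) := by
    rw [← Real.exp_add, ← Real.exp_add]
    congr 1
    rw [norm_sub_sq_real w u, norm_sub_sq_real w ((2 : ℝ) • u), inner_smul_right, norm_smul, div_eq_mul_inv, ← hb]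
    norm_num
    ring
  rw [e1, e2, e3]
  have h3 : 2 * (f * g) ≤ l * f ^ 2 + l⁻¹ * g ^ 2 := by
    have := mul_nonneg (inv_pos.2 hl).le (sq_nonneg (l * f - g))
    have h4 : l⁻¹ * (l * f - g) ^ 2 = l * f ^ 2 + l⁻¹ * g ^ 2 - 2 * (f * g) := by
      field_simp; ring
    linarith
  calc c * (Real.exp (‖u‖ ^ 2 / (2 * σ ^ 2)) * (f * g))
      = c * Real.exp (‖u‖ ^ 2 / (2 * σ ^ 2)) / 2 * (2 * (f * g)) := by ring
    _ ≤ c * Real.exp (‖u‖ ^ 2 / (2 * σ ^ 2)) / 2 * (l * f ^ 2 + l⁻¹ * g ^ 2) := by gcongr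
    _ = _ := by ring

/-- The density comparison is integrated over A, and the law centred at θ + 2u gives A mass at most
1. The weight `l` stays free, to be balanced against the number of hypotheses. -/
theorem gaussianLaw_add_real_le {d : ℕ} (θ u : EuclideanSpace ℝ (Fin d)) {σ l : ℝ} (hσ : 0 < σ)
    (hl : 0 < l) {A : Set (EuclideanSpace ℝ (Fin d))} (hA : MeasurableSet A) :
    (gaussianLaw (θ + u) σ).real A ≤ Real.exp (‖u‖ ^ 2 / (2 * σ ^ 2)) / 2 *
      (l * (gaussianLaw θ σ).real A + l⁻¹) := by
  have h : ∀ v : EuclideanSpace ℝ (Fin d),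
      (gaussianLaw v σ).real A = ∫ y in A, gaussianDensity v σ y := by
    intro v
    rw [measureReal_def, gaussianLaw_eq_withDensity v hσ, withDensity_apply _ hA,
      integral_eq_lintegral_of_nonneg_ae
        (Filter.Eventually.of_forall fun y => gaussianDensity_nonneg v y σ)
        (continuous_gaussianDensity v σ).aestronglyMeasurable]
  have h1 : (gaussianLaw (θ + (2 : ℝ) • u) σ).real A ≤ 1 := measureReal_le_one
  calc (gaussianLaw (θ + u) σ).real A
      ≤ Real.exp (‖u‖ ^ 2 / (2 * σ ^ 2)) / 2 *
      (l * (gaussianLaw θ σ).real A + l⁻¹ * (gaussianLaw (θ + (2 : ℝ) • u) σ).real A) := by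
        rw [h, h, h, ← integral_const_mul, ← integral_const_mul, ← integral_add, ← integral_const_mul]
        · refine setIntegral_mono_on ?_ ?_ hA fun y _ => gaussianDensity_add_le θ u y hl
          · exact (gaussianDensity_integrable _ hσ).integrableOn
          · exact ((((gaussianDensity_integrable _ hσ).const_mul _).add
              ((gaussianDensity_integrable _ hσ).const_mul _)).const_mul _).integrableOn
        · exact ((gaussianDensity_integrable _ hσ).const_mul _).integrableOn
        · exact ((gaussianDensity_integrable _ hσ).const_mul _).integrableOn
    _ ≤ _ := by
        have : 0 ≤ l⁻¹ := by positivity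
        gcongr
        nlinarith

/-! ### Gaussian excess over a threshold -/

theorem sq_max_sub_le {x t l : ℝ} (hl : 1 ≤ l) :
    max (|x| - t) 0 ^ 2 ≤ 2 * Real.exp (-(l * t)) * (Real.exp (l * x) + Real.exp (-l * x)) := by
  have h0 : Real.exp (l * |x|) ≤ Real.exp (l * x) + Real.exp (-l * x) := by
    rcases abs_cases x with ⟨h, _⟩ | ⟨h, _⟩ <;> rw [h]
    · linarith [Real.exp_pos (-l * x)]
    · rw [show l * -x = -l * x by ring]; linarith [Real.exp_pos (l * x)]
  have h1 : max (|x| - t) 0 ^ 2 ≤ 2 * Real.exp (l * (|x| - t)) := by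
    rcases le_total (|x| - t) 0 with h | h
    · rw [max_eq_right h, zero_pow two_ne_zero]; positivity
    · rw [max_eq_left h]
      -- z² ≤ 2 exp z for z ≥ 0; the assumption l ≥ 1 allows z = l(|x| - t).
      have h2 := Real.quadratic_le_exp_of_nonneg (mul_nonneg (zero_le_one.trans hl) h)
      have h3 : (|x| - t) ^ 2 ≤ (l * (|x| - t)) ^ 2 := by
        apply pow_le_pow_left₀ h
        nlinarith
      have h4 : 0 ≤ l * (|x| - t) := mul_nonneg (zero_le_one.trans hl) h
      linarith
  calc _ ≤ 2 * Real.exp (l * (|x| - t)) := h1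
    _ = 2 * Real.exp (-(l * t)) * Real.exp (l * |x|) := by
      rw [mul_assoc, ← Real.exp_add]; congr 2; ring
    _ ≤ _ := by gcongr

/-- The expected squared excess of a centred Gaussian coordinate over a threshold. -/
theorem lintegral_sq_excess_le {d : ℕ} (θ : EuclideanSpace ℝ (Fin d)) {σ t l : ℝ} (hσ : 0 < σ)
    (hl : 1 ≤ l) (i : Fin d) :
    ∫⁻ y, ENNReal.ofReal (max (|y i - θ i| - σ * t) 0 ^ 2) ∂(gaussianLaw θ σ) ≤
      ENNReal.ofReal (4 * σ ^ 2 * Real.exp (l ^ 2 / 2 - l * t)) := by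
  have hmp := map_eval_gaussianLaw θ σ i
  have hv : ((σ ^ 2).toNNReal : ℝ) = σ ^ 2 := Real.coe_toNNReal _ (sq_nonneg σ)
  have hexp : ∀ r : ℝ, Integrable (fun x => Real.exp (r * x)) (gaussianReal (θ i) (σ ^ 2).toNNReal) :=
    fun r => integrable_exp_mul_gaussianReal r
  have hmgf : ∀ r : ℝ, ∫ x, Real.exp (r * x) ∂(gaussianReal (θ i) (σ ^ 2).toNNReal) =
      Real.exp (θ i * r + σ ^ 2 * r ^ 2 / 2) := by
    intro r
    have := congrFun (mgf_id_gaussianReal (μ := θ i) (v := (σ ^ 2).toNNReal)) r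
    rw [hv] at this
    exact this
  rw [hmp.lintegral_comp (f := fun x => ENNReal.ofReal (max (|x - θ i| - σ * t) 0 ^ 2)) (by fun_prop)]
  set K := 2 * σ ^ 2 * Real.exp (-(l * t))
  have hpt : ∀ x : ℝ, max (|x - θ i| - σ * t) 0 ^ 2 ≤
      K * (Real.exp (-(l / σ * θ i)) * Real.exp (l / σ * x) +
        Real.exp (l / σ * θ i) * Real.exp (-(l / σ) * x)) := by
    intro x
    have h := sq_max_sub_le (x := (x - θ i) / σ) (t := t) hl
    have e : max (|x - θ i| - σ * t) 0 = σ * max (|(x - θ i) / σ| - t) 0 := by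
      rw [mul_max_of_nonneg _ _ hσ.le, mul_zero, abs_div, abs_of_pos hσ, mul_sub,
        mul_div_cancel₀ _ hσ.ne']
    rw [e, mul_pow, ← Real.exp_add, ← Real.exp_add]
    have h' := mul_le_mul_of_nonneg_left h (sq_nonneg σ)
    refine h'.trans (le_of_eq ?_)
    have a1 : l * ((x - θ i) / σ) = -(l / σ * θ i) + l / σ * x := by ring
    have a2 : -l * ((x - θ i) / σ) = l / σ * θ i + -(l / σ) * x := by ring
    rw [a1, a2]
    simp only [K]
    ring
  have hint : Integrable (fun x => K * (Real.exp (-(l / σ * θ i)) * Real.exp (l / σ * x) +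
        Real.exp (l / σ * θ i) * Real.exp (-(l / σ) * x)))
        (gaussianReal (θ i) (σ ^ 2).toNNReal) :=
    (((hexp _).const_mul _).add ((hexp _).const_mul _)).const_mul _
  calc _ ≤ ∫⁻ x, ENNReal.ofReal (K * (Real.exp (-(l / σ * θ i)) * Real.exp (l / σ * x) +
        Real.exp (l / σ * θ i) * Real.exp (-(l / σ) * x))) ∂(gaussianReal (θ i) (σ ^ 2).toNNReal) :=
        lintegral_mono fun x => ENNReal.ofReal_le_ofReal (hpt x)
    _ = ENNReal.ofReal (4 * σ ^ 2 * Real.exp (l ^ 2 / 2 - l * t)) := by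
        rw [← ofReal_integral_eq_lintegral_ofReal hint
          (Filter.Eventually.of_forall fun x => by positivity), integral_const_mul,
          integral_add ((hexp _).const_mul _) ((hexp _).const_mul _), integral_const_mul,
          integral_const_mul, hmgf, hmgf, ← Real.exp_add, ← Real.exp_add]
        congr 1
        have a1 : -(l / σ * θ i) + (θ i * (l / σ) + σ ^ 2 * (l / σ) ^ 2 / 2) = l ^ 2 / 2 := by
          field_simp; ring
        have a2 : l / σ * θ i + (θ i * -(l / σ) + σ ^ 2 * (-(l / σ)) ^ 2 / 2) = l ^ 2 / 2 := by
          field_simp; ring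
        rw [a1, a2, Real.exp_sub]
        simp only [K, Real.exp_neg]
        field_simp
        ring

/-! ### Risk of the Euclidean projection -/

section Projection

variable {d : ℕ} {Θ : Set (EuclideanSpace ℝ (Fin d))}
  {proj : EuclideanSpace ℝ (Fin d) → EuclideanSpace ℝ (Fin d)}

theorem IsProjection.infDist_eq (h : IsProjection Θ proj) (y : EuclideanSpace ℝ (Fin d)) :
    Metric.infDist y Θ = ‖proj y - y‖ := by
  refine le_antisymm ?_ ?_
  · have := Metric.infDist_le_dist_of_mem (x := y) (h y).1
    rwa [dist_comm, dist_eq_norm] at this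
  · refine (Metric.le_infDist ⟨_, (h y).1⟩).2 fun z hz => ?_
    rw [dist_comm, dist_eq_norm]
    exact le_of_sq_le_sq ((h y).2 z hz) (norm_nonneg _)

/-- ‖z‖² - dist(z, Θ)² is the supremum over ϑ in Θ of the affine functions 2⟨ϑ, z⟩ - ‖ϑ‖², attained
at z = y by ϑ = proj y. Hence it is convex with subgradient 2 proj y at y. -/
theorem IsProjection.inner_le (h : IsProjection Θ proj) (y z : EuclideanSpace ℝ (Fin d)) :
    ‖y‖ ^ 2 - Metric.infDist y Θ ^ 2 + 2 * ⟪proj y, z - y⟫ ≤ ‖z‖ ^ 2 - Metric.infDist z Θ ^ 2 := by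
  have h1 := (h z).2 (proj y) (h y).1
  rw [h.infDist_eq, h.infDist_eq]
  rw [norm_sub_sq_real (proj y) z] at h1
  rw [norm_sub_sq_real (proj y) y, inner_sub_right]
  linarith

theorem IsProjection.fderiv_eq (h : IsProjection Θ proj) {y : EuclideanSpace ℝ (Fin d)}
    (hy : DifferentiableAt ℝ (fun z => Metric.infDist z Θ) y) :
    fderiv ℝ (fun z => ‖z‖ ^ 2 - Metric.infDist z Θ ^ 2) y = (2 : ℝ) • innerSL ℝ (proj y) := by
  have hd : DifferentiableAt ℝ (fun z : EuclideanSpace ℝ (Fin d) => ‖z‖ ^ 2 - Metric.infDist z Θ ^ 2) y :=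
    (differentiableAt_id.norm_sq ℝ).sub (hy.pow 2)
  have hmin : IsLocalMin (fun z => ‖z‖ ^ 2 - Metric.infDist z Θ ^ 2 -
      ((2 : ℝ) • innerSL ℝ (proj y)) z) y := by
    refine Filter.Eventually.of_forall fun z => ?_
    have := h.inner_le y z
    rw [inner_sub_right] at this
    simp only [smul_apply, innerSL_apply_apply, smul_eq_mul]
    linarith
  have h0 := hmin.fderiv_eq_zero
  rw [fderiv_fun_sub hd (ContinuousLinearMap.differentiableAt _), ContinuousLinearMap.fderiv] at h0
  exact sub_eq_zero.1 h0

/-- The distance to Θ is Lipschitz, hence differentiable almost everywhere by Rademacher. There proj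
y is half the gradient of ‖z‖² - dist(z, Θ)², and derivatives are measurable. -/
theorem IsProjection.exists_measurable_ae_eq (h : IsProjection Θ proj) :
    ∃ est : EuclideanSpace ℝ (Fin d) → EuclideanSpace ℝ (Fin d), Measurable est ∧
      proj =ᵐ[volume] est := by
  refine ⟨fun y => (1 / 2 : ℝ) • (InnerProductSpace.toDual ℝ (EuclideanSpace ℝ (Fin d))).symm
    (fderiv ℝ (fun z => ‖z‖ ^ 2 - Metric.infDist z Θ ^ 2) y), ?_, ?_⟩
  · have := ((InnerProductSpace.toDual ℝ (EuclideanSpace ℝ (Fin d))).symm.continuous.measurable).comp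
      (measurable_fderiv ℝ fun z : EuclideanSpace ℝ (Fin d) => ‖z‖ ^ 2 - Metric.infDist z Θ ^ 2)
    exact this.const_smul (1 / 2 : ℝ)
  · filter_upwards [(Metric.lipschitz_infDist_pt Θ).ae_differentiableAt (μ := volume)] with y hy
    rw [h.fderiv_eq hy, map_smul, smul_smul]
    norm_num
    exact ((InnerProductSpace.toDual ℝ (EuclideanSpace ℝ (Fin d))).symm_apply_apply (proj y)).symm

theorem IsProjection.minimaxRisk_le (h : IsProjection Θ proj) {σ : ℝ} (hσ : 0 < σ) :
    minimaxRisk Θ σ ≤ worstCaseRisk Θ σ proj := by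
  obtain ⟨est, hm, hae⟩ := h.exists_measurable_ae_eq
  refine (iInf₂_le est hm).trans (iSup₂_mono fun θ _ => ?_)
  refine (lintegral_congr_ae ?_).le
  filter_upwards [(gaussianLaw_absolutelyContinuous θ hσ).ae_le hae] with y hy
  rw [hy]

theorem IsProjection.norm_sq_sub_le (h : IsProjection Θ proj) {θ : EuclideanSpace ℝ (Fin d)}
    (hθ : θ ∈ Θ) (y : EuclideanSpace ℝ (Fin d)) :
    ‖proj y - θ‖ ^ 2 ≤ ∑ i, 2 * (y i - θ i) * (proj y i - θ i) := by
  have h1 := (h y).2 θ hθ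
  have h2 : proj y - y = (proj y - θ) - (y - θ) := by abel
  rw [h2, norm_sub_sq_real, ← norm_neg (θ - y), neg_sub] at h1
  have h3 : ⟪proj y - θ, y - θ⟫ = ∑ i, (y i - θ i) * (proj y i - θ i) := by
    simp [PiLp.inner_apply]
  simp_rw [mul_assoc, ← Finset.mul_sum, ← h3]
  linarith

/-- If linear terms at the threshold level `τ` are dominated by half the squared error plus `B`,
the squared error is controlled by `B` and the excesses of the noise over `τ`. -/
theorem IsProjection.norm_sq_sub_le_excess (h : IsProjection Θ proj) {θ : EuclideanSpace ℝ (Fin d)}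
    (hθ : θ ∈ Θ) (y : EuclideanSpace ℝ (Fin d)) {τ B : ℝ}
    (hB : ∑ i, 2 * τ * |proj y i - θ i| ≤ ‖proj y - θ‖ ^ 2 / 2 + B) :
    ‖proj y - θ‖ ^ 2 ≤ 4 * B + ∑ i, 16 * max (|y i - θ i| - τ) 0 ^ 2 := by
  have h1 := h.norm_sq_sub_le hθ y
  have h2 : ∀ i, 2 * (y i - θ i) * (proj y i - θ i) ≤
      2 * τ * |proj y i - θ i| + (proj y i - θ i) ^ 2 / 4 + 4 * max (|y i - θ i| - τ) 0 ^ 2 := by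
    intro i
    have a1 : (y i - θ i) * (proj y i - θ i) ≤ |y i - θ i| * |proj y i - θ i| := by
      rw [← abs_mul]; exact le_abs_self _
    have a2 : |y i - θ i| ≤ τ + max (|y i - θ i| - τ) 0 := by
      linarith [le_max_left (|y i - θ i| - τ) 0]
    have a3 := mul_le_mul_of_nonneg_right a2 (abs_nonneg (proj y i - θ i))
    -- Excess e times u costs 2eu ≤ u²/4 + 4e². Together with the half allowed by `hB`, three
    -- quarters of the squared error move to the left, whence the factors 4 and 16.
    have a4 := sq_nonneg (|proj y i - θ i| / 2 - 2 * max (|y i - θ i| - τ) 0)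
    rw [← sq_abs (proj y i - θ i)]
    nlinarith
  have h3 := Finset.sum_le_sum fun i (_ : i ∈ Finset.univ) => h2 i
  have h4 : ‖proj y - θ‖ ^ 2 = ∑ i, (proj y i - θ i) ^ 2 := by
    simp [EuclideanSpace.real_norm_sq_eq]
  rw [Finset.sum_add_distrib, Finset.sum_add_distrib, ← Finset.sum_div, ← h4, ← Finset.mul_sum (a := 4)] at h3
  rw [← Finset.mul_sum]
  linarith

theorem IsProjection.worstCaseRisk_le (h : IsProjection Θ proj) {σ t l B : ℝ} (hσ : 0 < σ)
    (hl : 1 ≤ l) (hB0 : 0 ≤ B)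
    (hB : ∀ θ ∈ Θ, ∀ v ∈ Θ, ∑ i, 2 * (σ * t) * |v i - θ i| ≤ ‖v - θ‖ ^ 2 / 2 + B) :
    worstCaseRisk Θ σ proj ≤
      ENNReal.ofReal (4 * B + d * (64 * σ ^ 2 * Real.exp (l ^ 2 / 2 - l * t))) := by
  refine iSup₂_le fun θ hθ => ?_
  calc ∫⁻ y, ENNReal.ofReal (‖proj y - θ‖ ^ 2) ∂(gaussianLaw θ σ)
      ≤ ∫⁻ y, (ENNReal.ofReal (4 * B) +
          ∑ i, 16 * ENNReal.ofReal (max (|y i - θ i| - σ * t) 0 ^ 2)) ∂(gaussianLaw θ σ) := by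
        refine lintegral_mono fun y => ?_
        refine (ENNReal.ofReal_le_ofReal
          (h.norm_sq_sub_le_excess hθ y (hB θ hθ _ (h y).1))).trans ?_
        rw [ENNReal.ofReal_add (by positivity) (by positivity),
          ENNReal.ofReal_sum_of_nonneg fun _ _ => by positivity]
        gcongr with i
        rw [ENNReal.ofReal_mul (by norm_num)]
        norm_num
    _ = ENNReal.ofReal (4 * B) + ∑ i, 16 * ∫⁻ y,
          ENNReal.ofReal (max (|y i - θ i| - σ * t) 0 ^ 2) ∂(gaussianLaw θ σ) := by
        rw [lintegral_add_left measurable_const, lintegral_const, measure_univ, mul_one,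
          lintegral_finsetSum _ fun i _ => by fun_prop]
        congr 1
        exact Finset.sum_congr rfl fun i _ => lintegral_const_mul _ (by fun_prop)
    _ ≤ ENNReal.ofReal (4 * B) + ∑ _i : Fin d, 16 *
          ENNReal.ofReal (4 * σ ^ 2 * Real.exp (l ^ 2 / 2 - l * t)) := by
        gcongr with i
        exact lintegral_sq_excess_le θ hσ hl i
    _ = _ := by
        rw [Finset.sum_const, Finset.card_univ, Fintype.card_fin, nsmul_eq_mul,
          ENNReal.ofReal_add (by positivity) (by positivity), ENNReal.ofReal_mul (p := (d : ℝ))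
          (by positivity), ENNReal.ofReal_natCast, mul_assoc 64, show (64 : ℝ) = 16 * 4 by norm_num, mul_assoc 16,
          ENNReal.ofReal_mul (p := 16) (by norm_num), mul_assoc 4]
        norm_num

/-- The risk of the projection is at most a multiple of `d σ²`, for every `Θ`. -/
theorem IsProjection.worstCaseRisk_le_dim (h : IsProjection Θ proj) {σ : ℝ} (hσ : 0 < σ) :
    worstCaseRisk Θ σ proj ≤ ENNReal.ofReal (128 * (d * σ ^ 2)) := by
  -- At threshold 0 all the noise is excess and no geometry of Θ is needed.
  refine (h.worstCaseRisk_le (t := 0) (l := 1) (B := 0) hσ le_rfl le_rfl ?_).trans ?_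
  · intro θ _ v _
    simp only [mul_zero, zero_mul, Finset.sum_const_zero]
    positivity
  · refine ENNReal.ofReal_le_ofReal ?_
    have h1 : Real.exp (1 ^ 2 / 2 - 1 * 0) ≤ 2 := by
      have h2 : Real.exp (1 / 2) ^ 2 ≤ 2 ^ 2 := by
        rw [← Real.exp_nat_mul]
        norm_num
        linarith [Real.exp_one_lt_d9]
      have := le_of_sq_le_sq h2 (by norm_num)
      norm_num at this ⊢
      exact this
    have h2 : 0 ≤ (d : ℝ) * σ ^ 2 := by positivity
    nlinarith

theorem IsProjection.worstCaseRisk_le_diam (h : IsProjection Θ proj) {σ R : ℝ}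
    (hR : ∀ θ ∈ Θ, ‖θ‖ ^ 2 ≤ R) :
    worstCaseRisk Θ σ proj ≤ ENNReal.ofReal (4 * R) := by
  refine iSup₂_le fun θ hθ => ?_
  calc ∫⁻ y, ENNReal.ofReal (‖proj y - θ‖ ^ 2) ∂(gaussianLaw θ σ)
      ≤ ∫⁻ _, ENNReal.ofReal (4 * R) ∂(gaussianLaw θ σ) := by
        refine lintegral_mono fun y => ENNReal.ofReal_le_ofReal ?_
        have h1 := hR _ (h y).1
        have h2 := hR _ hθ
        have h3 := norm_sub_le (proj y) θ
        have h4 := pow_le_pow_left₀ (norm_nonneg _) h3 2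
        nlinarith [sq_nonneg (‖proj y‖ - ‖θ‖)]
    _ = _ := by simp

end Projection

/-- The bounds V > 0 below and U above also keep the minimax risk away from 0 and ∞, so that the
quotient in `ℝ≥0∞` behaves as expected. -/
theorem mleOrderOptimal_of_bounds {d : ℕ} {Θ : Set (EuclideanSpace ℝ (Fin d))} {σ U V : ℝ} {C : ℝ≥0}
    (hσ : 0 < σ) (hV : 0 < V) (hUV : U ≤ C * V)
    (hU : ∀ proj, IsProjection Θ proj → worstCaseRisk Θ σ proj ≤ ENNReal.ofReal U)
    (hL : ENNReal.ofReal V ≤ minimaxRisk Θ σ) : MLEOrderOptimal C Θ σ := by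
  intro proj hp
  have h1 := hp.minimaxRisk_le hσ
  have h2 := hU proj hp
  have h0 : minimaxRisk Θ σ ≠ 0 := ((ENNReal.ofReal_pos.2 hV).trans_le hL).ne'
  have ht : minimaxRisk Θ σ ≠ ∞ := ((h1.trans h2).trans_lt ENNReal.ofReal_lt_top).ne
  refine ⟨?_, ?_⟩
  · rw [competitiveRatio, ENNReal.le_div_iff_mul_le (Or.inl h0) (Or.inl ht), one_mul]
    exact h1
  · refine ENNReal.div_le_of_le_mul (h2.trans ?_)
    calc ENNReal.ofReal U ≤ ENNReal.ofReal (C * V) := ENNReal.ofReal_le_ofReal hUV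
      _ = C * ENNReal.ofReal V := by rw [ENNReal.ofReal_mul C.coe_nonneg, ENNReal.ofReal_coe_nnreal]
      _ ≤ _ := by gcongr

/-! ### Minimax lower bound from spikes in blocks -/

theorem sum_sum_update {ι κ M : Type*} [Fintype ι] [DecidableEq ι] [Fintype κ] [AddCommMonoid M]
    (G : (ι → κ) → M) (j : ι) :
    ∑ h : ι → κ, ∑ o : κ, G (Function.update h j o) = Fintype.card κ • ∑ h, G h := by
  -- Exchanging the entry h j with the fresh value o is a bijection of pairs: resampling one
  -- coordinate of a uniform h leaves it uniform.
  have hinv : Function.Involutive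
      fun x : (ι → κ) × κ => (Function.update x.1 j x.2, x.1 j) := by
    rintro ⟨h, o⟩
    simp
  rw [← Fintype.sum_prod_type' (f := fun h o => G (Function.update h j o)),
    Fintype.sum_equiv hinv.toPerm (fun x : (ι → κ) × κ => G (Function.update x.1 j x.2))
      (fun x => G x.1) fun x => rfl, Fintype.sum_prod_type, Finset.smul_sum]
  simp

section Spikes

variable {d n m : ℕ} (e : Fin n × Fin m ↪ Fin d) (a : ℝ)

open Classical in
/-- The vector with at most one nonzero entry, equal to `a`, in each of `n` blocks. -/
noncomputable def spikeVec (h : Fin n → Option (Fin m)) : EuclideanSpace ℝ (Fin d) :=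
  WithLp.toLp 2 fun i => if ∃ x, e x = i ∧ h x.1 = some x.2 then a else 0

theorem spikeVec_apply (h : Fin n → Option (Fin m)) (j : Fin n) (k : Fin m) :
    spikeVec e a h (e (j, k)) = if h j = some k then a else 0 := by
  simp [spikeVec]

theorem spikeVec_eq_zero_or (h : Fin n → Option (Fin m)) (i : Fin d) :
    spikeVec e a h i = 0 ∨ spikeVec e a h i = a := by
  by_cases hx : ∃ x, e x = i ∧ h x.1 = some x.2
  · right; exact if_pos hx
  · left; exact if_neg hx

theorem card_spikeVec_ne_zero_le (h : Fin n → Option (Fin m)) :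
    (Finset.univ.filter fun i => spikeVec e a h i ≠ 0).card ≤ n := by
  classical
  refine le_of_le_of_eq ?_ (Finset.card_fin n)
  have hx : ∀ i ∈ Finset.univ.filter fun i => spikeVec e a h i ≠ 0,
      ∃ x, e x = i ∧ h x.1 = some x.2 := by
    intro i hi
    by_contra hx
    exact (Finset.mem_filter.1 hi).2 (if_neg hx)
  rcases isEmpty_or_nonempty (Fin n × Fin m) with hE | hE
  · rw [Finset.eq_empty_of_forall_notMem fun i hi => hE.elim (hx i hi).choose]
    simp
  choose! f hf using hx
  refine Finset.card_le_card_of_injOn (fun i => (f i).1) (fun _ _ => Finset.mem_univ _) ?_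
  intro i hi i' hi' hii
  obtain ⟨h1, h2⟩ := hf i hi
  obtain ⟨h3, h4⟩ := hf i' hi'
  have h5 : (f i).1 = (f i').1 := hii
  rw [h5, h4] at h2
  rw [← h1, ← h3, Prod.ext h5 (Option.some.inj h2).symm]

/-- All m + 1 hypotheses for block j are compared with a single reference, the one with no spike
there. -/
theorem exists_spikeVec_update (h : Fin n → Option (Fin m)) (j : Fin n) (o : Option (Fin m)) :
    ∃ u, spikeVec e a (Function.update h j o) = spikeVec e a (Function.update h j none) + u ∧
      ‖u‖ ^ 2 ≤ a ^ 2 := by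
  classical
  rcases o with _ | k
  · exact ⟨0, by simp, by simp [sq_nonneg]⟩
  refine ⟨EuclideanSpace.single (e (j, k)) a, ?_, by simp⟩
  ext i
  rw [PiLp.add_apply]
  by_cases hi : i ∈ Set.range e
  · obtain ⟨⟨j', k'⟩, rfl⟩ := hi
    rw [spikeVec_apply, spikeVec_apply]
    by_cases hj : j' = j
    · subst hj
      by_cases hk : k' = k
      · simp [hk]
      · simp [hk, Ne.symm hk]
    · simp [hj]
  · have h0 : ∀ h', spikeVec e a h' i = 0 := fun h' => if_neg fun ⟨x, hx, _⟩ => hi ⟨x, hx⟩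
    have h1 : i ≠ e (j, k) := fun h => hi ⟨_, h.symm⟩
    simp [h0, h1]

/-- The squared error within block `j`, when the spike of that block is at `o`. -/
noncomputable def blockLoss (v : EuclideanSpace ℝ (Fin d)) (j : Fin n) (o : Option (Fin m)) : ℝ :=
  ∑ k, (v (e (j, k)) - if o = some k then a else 0) ^ 2

theorem sum_blockLoss_le (v : EuclideanSpace ℝ (Fin d)) (h : Fin n → Option (Fin m)) :
    ∑ j, blockLoss e a v j (h j) ≤ ‖v - spikeVec e a h‖ ^ 2 := by
  classical
  rw [EuclideanSpace.real_norm_sq_eq]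
  calc ∑ j, blockLoss e a v j (h j) = ∑ x, (v - spikeVec e a h) (e x) ^ 2 := by
        rw [Fintype.sum_prod_type]
        simp [blockLoss, spikeVec_apply]
    _ = ∑ i ∈ Finset.univ.map e, (v - spikeVec e a h) i ^ 2 := by rw [Finset.sum_map]
    _ ≤ _ := Finset.sum_le_univ_sum_of_nonneg fun _ => sq_nonneg _

/-- Distinct hypotheses differ by |a| in some coordinate, so one value cannot be within |a|/2 of
both. This makes the success events of the hypotheses disjoint. -/
theorem blockLoss_eq_of_lt {v : EuclideanSpace ℝ (Fin d)} {j : Fin n} {o o' : Option (Fin m)}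
    (h : blockLoss e a v j o < a ^ 2 / 4) (h' : blockLoss e a v j o' < a ^ 2 / 4) : o = o' := by
  by_contra hne
  obtain ⟨k, hk⟩ : ∃ k, ((if o = some k then a else 0) - if o' = some k then a else 0) ^ 2 = a ^ 2 := by
    rcases o with _ | k
    · rcases o' with _ | k'
      · exact absurd rfl hne
      · exact ⟨k', by simp⟩
    · refine ⟨k, ?_⟩
      rw [if_pos rfl, if_neg (Ne.symm hne), sub_zero]
  have h1 := (Finset.single_le_sum (f := fun k => (v (e (j, k)) - if o = some k then a else 0) ^ 2)
    (fun _ _ => sq_nonneg _) (Finset.mem_univ k)).trans_lt h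
  have h2 := (Finset.single_le_sum (f := fun k => (v (e (j, k)) - if o' = some k then a else 0) ^ 2)
    (fun _ _ => sq_nonneg _) (Finset.mem_univ k)).trans_lt h'
  simp only at h1 h2
  generalize (if o = some k then a else 0) = b at *
  generalize (if o' = some k then a else 0) = c at *
  nlinarith [sq_nonneg (v (e (j, k)) - b + (v (e (j, k)) - c))]

/-- The Bayes risk within one block. -/
theorem le_sum_lintegral_blockLoss {σ : ℝ} (hσ : 0 < σ) (hm : 1 ≤ m)
    (ha : a ^ 2 ≤ σ ^ 2 * Real.log (1 + m) / 2)
    {est : EuclideanSpace ℝ (Fin d) → EuclideanSpace ℝ (Fin d)} (hest : Measurable est)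
    (h : Fin n → Option (Fin m)) (j : Fin n) :
    ENNReal.ofReal ((m + 1) * (a ^ 2 / 32)) ≤ ∑ o, ∫⁻ y, ENNReal.ofReal (blockLoss e a (est y) j o)
      ∂(gaussianLaw (spikeVec e a (Function.update h j o)) σ) := by
  classical
  set P : Option (Fin m) → Measure (EuclideanSpace ℝ (Fin d)) :=
    fun o => gaussianLaw (spikeVec e a (Function.update h j o)) σ with hP
  have hPp : ∀ o, IsProbabilityMeasure (P o) := fun o => by rw [hP]; infer_instance
  have hmeas : ∀ o, Measurable fun y => blockLoss e a (est y) j o := by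
    intro o
    unfold blockLoss
    fun_prop
  -- `A o` is the event that the estimator is accurate in block j when tested against hypothesis o.
  set A : Option (Fin m) → Set (EuclideanSpace ℝ (Fin d)) :=
    fun o => {y | blockLoss e a (est y) j o < a ^ 2 / 4} with hA
  have hAm : ∀ o, MeasurableSet (A o) := fun o => measurableSet_lt (hmeas o) measurable_const
  have hdisj : Pairwise (Function.onFun Disjoint A) := by
    intro o o' hne
    refine Set.disjoint_left.2 fun y hy hy' => hne (blockLoss_eq_of_lt e a hy hy')
  have hsum0 : ∑ o, (P none).real (A o) ≤ 1 := by
    rw [← measureReal_iUnion_fintype hdisj hAm]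
    exact measureReal_le_one
  -- With s = (1 + m)^(1/4), the bound on a² makes the likelihood factor at most s. The weight l =
  -- s² balances l · 1 against (1 + m)/l, so the success probabilities sum to at most s³, a fraction
  -- 1/s ≤ 7/8 of the number of hypotheses.
  set s : ℝ := Real.exp (Real.log (1 + m) / 4) with hs
  have hm1 : (1 : ℝ) ≤ m := by exact_mod_cast hm
  have hs4 : s ^ 4 = 1 + m := by
    rw [hs, ← Real.exp_nat_mul]
    push_cast
    rw [mul_div_cancel₀ _ (by norm_num), Real.exp_log (by positivity)]
  have hspos : 0 < s := Real.exp_pos _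
  have hs87 : 8 / 7 ≤ s := by
    refine le_of_pow_le_pow_left₀ (n := 4) (by norm_num) hspos.le ?_
    rw [hs4]; norm_num; linarith
  have hlow : ∀ o, (P o).real (A o) ≤ s / 2 * (s ^ 2 * (P none).real (A o) + (s ^ 2)⁻¹) := by
    intro o
    obtain ⟨u, hu, hu2⟩ := exists_spikeVec_update e a h j o
    have h1 := gaussianLaw_add_real_le (spikeVec e a (Function.update h j none)) u hσ
      (l := s ^ 2) (by positivity) (hAm o)
    rw [← hu] at h1
    refine h1.trans ?_
    have h2 : ‖u‖ ^ 2 / (2 * σ ^ 2) ≤ Real.log (1 + m) / 4 := by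
      rw [div_le_iff₀ (by positivity)]
      linarith
    have h3 := Real.exp_le_exp.2 h2
    gcongr
  have hsum : ∑ o, (P o).real (A o) ≤ 7 / 8 * (m + 1) := by
    calc ∑ o, (P o).real (A o) ≤ ∑ o, s / 2 * (s ^ 2 * (P none).real (A o) + (s ^ 2)⁻¹) :=
          Finset.sum_le_sum fun o _ => hlow o
      _ = s / 2 * (s ^ 2 * ∑ o, (P none).real (A o) + (1 + m) * (s ^ 2)⁻¹) := by
          rw [← Finset.mul_sum, Finset.sum_add_distrib, ← Finset.mul_sum]
          simp [add_comm]
      _ ≤ s / 2 * (s ^ 2 * 1 + (1 + m) * (s ^ 2)⁻¹) := by gcongr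
      _ = s ^ 3 := by
          rw [← hs4]; field_simp; ring
      _ ≤ 7 / 8 * s ^ 4 := by nlinarith [pow_pos hspos 3]
      _ = _ := by rw [hs4]; ring
  -- Markov's inequality: failure costs at least a²/4, and the average failure probability is at
  -- least 1/8, giving a²/32.
  have hmarkov : ∀ o, ENNReal.ofReal (a ^ 2 / 4 * (1 - (P o).real (A o))) ≤
      ∫⁻ y, ENNReal.ofReal (blockLoss e a (est y) j o) ∂(P o) := by
    intro o
    have h1 := mul_meas_ge_le_lintegral (μ := P o) (hmeas o).ennreal_ofReal
      (ENNReal.ofReal (a ^ 2 / 4))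
    refine le_trans ?_ h1
    rw [ENNReal.ofReal_mul (by positivity)]
    gcongr
    rw [← probReal_compl_eq_one_sub (hAm o), ofReal_measureReal]
    refine measure_mono fun y hy => ?_
    exact ENNReal.ofReal_le_ofReal (not_lt.1 hy)
  calc _ ≤ ENNReal.ofReal (∑ o, a ^ 2 / 4 * (1 - (P o).real (A o))) := by
        refine ENNReal.ofReal_le_ofReal ?_
        rw [← Finset.mul_sum, Finset.sum_sub_distrib]
        have : ∑ _o : Option (Fin m), (1 : ℝ) = m + 1 := by simp
        rw [this]
        nlinarith [sq_nonneg a]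
    _ = ∑ o, ENNReal.ofReal (a ^ 2 / 4 * (1 - (P o).real (A o))) :=
        ENNReal.ofReal_sum_of_nonneg fun o _ =>
          mul_nonneg (by positivity) (sub_nonneg.2 measureReal_le_one)
    _ ≤ _ := Finset.sum_le_sum fun o _ => hmarkov o

/-- The worst case dominates the average over uniform h. For each j, resampling h j first reduces
that average to the Bayes risk of block j with the other blocks frozen; the blocks then add up. -/
theorem le_minimaxRisk_of_spikeVec_mem {Θ : Set (EuclideanSpace ℝ (Fin d))} {σ : ℝ} (hσ : 0 < σ)
    (hm : 1 ≤ m) (ha : a ^ 2 ≤ σ ^ 2 * Real.log (1 + m) / 2) (hΘ : ∀ h, spikeVec e a h ∈ Θ) :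
    ENNReal.ofReal (n * (a ^ 2 / 32)) ≤ minimaxRisk Θ σ := by
  classical
  refine le_iInf₂ fun est hest => ?_
  set G : Fin n → (Fin n → Option (Fin m)) → ℝ≥0∞ := fun j h =>
    ∫⁻ y, ENNReal.ofReal (blockLoss e a (est y) j (h j)) ∂(gaussianLaw (spikeVec e a h) σ) with hG
  have hnn : ∀ v j o, 0 ≤ blockLoss e a v j o := fun v j o =>
    Finset.sum_nonneg fun _ _ => sq_nonneg _
  have h1 : ∀ h, ∑ j, G j h ≤ worstCaseRisk Θ σ est := by
    intro h
    rw [hG, ← lintegral_finsetSum]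
    · refine le_trans (lintegral_mono fun y => ?_) (le_iSup₂ (f := fun θ (_ : θ ∈ Θ) =>
        ∫⁻ y, ENNReal.ofReal (‖est y - θ‖ ^ 2) ∂(gaussianLaw θ σ)) (spikeVec e a h) (hΘ h))
      rw [← ENNReal.ofReal_sum_of_nonneg fun j _ => hnn _ _ _]
      exact ENNReal.ofReal_le_ofReal (sum_blockLoss_le e a (est y) h)
    · intro j _
      unfold blockLoss
      fun_prop
  set N : ℝ≥0∞ := (Fintype.card (Fin n → Option (Fin m)) : ℝ≥0∞) with hN
  have h2 : ∀ j, N * ENNReal.ofReal ((m + 1) * (a ^ 2 / 32)) ≤ (m + 1) * ∑ h, G j h := by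
    intro j
    have h3 := sum_sum_update (G j) j
    have h4 : N * ENNReal.ofReal ((m + 1) * (a ^ 2 / 32)) =
        ∑ _h : Fin n → Option (Fin m), ENNReal.ofReal ((m + 1) * (a ^ 2 / 32)) := by
      rw [Finset.sum_const, nsmul_eq_mul, Finset.card_univ]
    have h5 : ((m : ℝ≥0∞) + 1) * ∑ h, G j h = Fintype.card (Option (Fin m)) • ∑ h, G j h := by
      rw [nsmul_eq_mul]; simp
    rw [h4, h5, ← h3]
    refine Finset.sum_le_sum fun h _ => ?_
    have := le_sum_lintegral_blockLoss e a hσ hm ha hest h j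
    simpa [hG] using this
  have hN0 : N * (m + 1) ≠ 0 := by simp [hN]
  have hNt : N * (m + 1) ≠ ∞ := by
    refine ENNReal.mul_ne_top (ENNReal.natCast_ne_top _) (by simp)
  rw [← ENNReal.mul_le_mul_iff_right hN0 hNt]
  calc N * (m + 1) * ENNReal.ofReal (n * (a ^ 2 / 32))
      = ∑ _j : Fin n, N * ENNReal.ofReal ((m + 1) * (a ^ 2 / 32)) := by
        rw [Finset.sum_const, nsmul_eq_mul, Finset.card_univ, Fintype.card_fin,
          ENNReal.ofReal_mul (by positivity), ENNReal.ofReal_mul (by positivity),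
          ENNReal.ofReal_add (by positivity) (by positivity)]
        simp only [ENNReal.ofReal_natCast, ENNReal.ofReal_one]
        ring
    _ ≤ ∑ j, (m + 1) * ∑ h, G j h := Finset.sum_le_sum fun j _ => h2 j
    _ = (m + 1) * ∑ h, ∑ j, G j h := by rw [← Finset.mul_sum, Finset.sum_comm]
    _ ≤ (m + 1) * ∑ _h : Fin n → Option (Fin m), worstCaseRisk Θ σ est := by
        gcongr with h
        exact h1 h
    _ = _ := by
        rw [Finset.sum_const, nsmul_eq_mul, Finset.card_univ]
        ring

end Spikes

/-- Minimax lower bound over sets containing the `{0, a}`-valued vectors with at most `n` nonzero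
entries. -/
theorem le_minimaxRisk {d n m : ℕ} {Θ : Set (EuclideanSpace ℝ (Fin d))} {σ a : ℝ} (hσ : 0 < σ)
    (hm : 1 ≤ m) (hnm : n * m ≤ d) (ha : a ^ 2 ≤ σ ^ 2 * Real.log (1 + m) / 2)
    (hΘ : ∀ θ : EuclideanSpace ℝ (Fin d), (∀ i, θ i = 0 ∨ θ i = a) →
      (Finset.univ.filter fun i => θ i ≠ 0).card ≤ n → θ ∈ Θ) :
    ENNReal.ofReal (n * (a ^ 2 / 32)) ≤ minimaxRisk Θ σ :=
  le_minimaxRisk_of_spikeVec_mem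
    (finProdFinEquiv.toEmbedding.trans (Fin.castLEEmb hnm)) a hσ hm ha fun h =>
      hΘ _ (spikeVec_eq_zero_or _ a h) (card_spikeVec_ne_zero_le _ a h)

theorem rpow_le_one_iff_of_nonneg {x z : ℝ} (hx : 0 ≤ x) (hz : 0 < z) : x ^ z ≤ 1 ↔ x ≤ 1 := by
  rw [← Real.one_rpow z, Real.rpow_le_rpow_iff hx zero_le_one hz, Real.one_rpow]

/-! ### Geometry of the balls -/

section Balls

variable {d : ℕ} {p : ℝ}

theorem mem_lpBall_ofReal (hp : 0 < p) (θ : EuclideanSpace ℝ (Fin d)) :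
    θ ∈ lpBall d (ENNReal.ofReal p) ↔ ∑ i, |θ i| ^ p ≤ 1 := by
  have h0 : (ENNReal.ofReal p).toReal = p := ENNReal.toReal_ofReal hp.le
  have hs : 0 ≤ ∑ i, |θ i| ^ p := Finset.sum_nonneg fun i _ => by positivity
  rw [lpBall, Set.mem_ofPred_eq, PiLp.norm_eq_sum (by rw [h0]; exact hp), h0]
  simp only [Real.norm_eq_abs]
  rw [rpow_le_one_iff_of_nonneg hs (by positivity)]

theorem mem_lpBall_top (θ : EuclideanSpace ℝ (Fin d)) : θ ∈ lpBall d ∞ ↔ ∀ i, |θ i| ≤ 1 := by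
  rw [lpBall, Set.mem_ofPred_eq, PiLp.norm_toLp, pi_norm_le_iff_of_nonneg zero_le_one]
  rfl

theorem sum_abs_rpow_le_of_card_le (hp : 0 < p) {n : ℕ} {a : ℝ} {θ : EuclideanSpace ℝ (Fin d)}
    (hθ : ∀ i, θ i = 0 ∨ θ i = a) (hn : (Finset.univ.filter fun i => θ i ≠ 0).card ≤ n) :
    ∑ i, |θ i| ^ p ≤ n * |a| ^ p := by
  have h1 : ∑ i, |θ i| ^ p = ∑ i ∈ Finset.univ.filter fun i => θ i ≠ 0, |a| ^ p := by
    rw [Finset.sum_filter]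
    refine Finset.sum_congr rfl fun i _ => ?_
    split_ifs with h
    · rw [(hθ i).resolve_left h]
    · rw [not_not.1 h, abs_zero, Real.zero_rpow hp.ne']
  rw [h1, Finset.sum_const, nsmul_eq_mul]
  gcongr

theorem sum_abs_rpow_le_of_abs_le (hp : 0 < p) {r : ℝ} {θ : EuclideanSpace ℝ (Fin d)}
    (hθ : ∀ i, |θ i| ≤ r) : ∑ i, |θ i| ^ p ≤ d * r ^ p := by
  calc ∑ i, |θ i| ^ p ≤ ∑ _i : Fin d, r ^ p := by
        gcongr with i
        exact hθ i
    _ = _ := by simp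

theorem abs_le_one_of_sum_abs_rpow_le (hp : 0 < p) {θ : EuclideanSpace ℝ (Fin d)}
    (hθ : ∑ i, |θ i| ^ p ≤ 1) (i : Fin d) : |θ i| ≤ 1 := by
  have h1 := (Finset.single_le_sum (f := fun i => |θ i| ^ p) (fun _ _ => by positivity)
    (Finset.mem_univ i)).trans hθ
  exact (rpow_le_one_iff_of_nonneg (abs_nonneg _) hp).1 h1

theorem sum_abs_rpow_le_one_of_le {q : ℝ} (hp : 0 < p) (hpq : p ≤ q) {θ : EuclideanSpace ℝ (Fin d)}
    (hθ : ∑ i, |θ i| ^ p ≤ 1) : ∑ i, |θ i| ^ q ≤ 1 := by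
  refine le_trans (Finset.sum_le_sum fun i _ => ?_) hθ
  exact Real.rpow_le_rpow_of_exponent_ge_of_imp (abs_nonneg _)
    (abs_le_one_of_sum_abs_rpow_le hp hθ i) hpq fun _ h => absurd h (hp.trans_le hpq).ne'

theorem norm_sq_le_one_of_sum_abs_rpow_le (hp : 0 < p) (hp2 : p ≤ 2) {θ : EuclideanSpace ℝ (Fin d)}
    (hθ : ∑ i, |θ i| ^ p ≤ 1) : ‖θ‖ ^ 2 ≤ 1 := by
  rw [EuclideanSpace.real_norm_sq_eq]
  simpa using sum_abs_rpow_le_one_of_le hp hp2 hθ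

/-- Power means with exponent p/2 ≥ 1 applied to the squares. The right-hand side is the squared
norm of a corner of the inscribed cube. -/
theorem norm_sq_le_of_sum_abs_rpow_le (hp : 2 ≤ p) (hd : 1 ≤ d) {θ : EuclideanSpace ℝ (Fin d)}
    (hθ : ∑ i, |θ i| ^ p ≤ 1) : ‖θ‖ ^ 2 ≤ d * ((d : ℝ) ^ (-(1 / p))) ^ 2 := by
  have hd0 : (0 : ℝ) < d := by exact_mod_cast hd
  have h1 := Real.rpow_sum_le_const_mul_sum_rpow (p := p / 2) (Finset.univ : Finset (Fin d))
    (fun i => θ i ^ 2) (by linarith)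
  have h2 : ∀ i, |θ i ^ 2| ^ (p / 2) = |θ i| ^ p := by
    intro i
    rw [abs_pow, ← Real.rpow_natCast, ← Real.rpow_mul (abs_nonneg _)]
    congr 1
    push_cast; ring
  have h3 : ∑ i, |θ i ^ 2| = ‖θ‖ ^ 2 := by
    rw [EuclideanSpace.real_norm_sq_eq]
    exact Finset.sum_congr rfl fun i _ => abs_of_nonneg (sq_nonneg _)
  simp_rw [h2] at h1
  rw [h3, Finset.card_univ, Fintype.card_fin] at h1
  have h4 : (‖θ‖ ^ 2) ^ (p / 2) ≤ (d : ℝ) ^ (p / 2 - 1) :=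
    h1.trans (mul_le_of_le_one_right (by positivity) hθ)
  have h5 : (d : ℝ) * ((d : ℝ) ^ (-(1 / p))) ^ 2 = (d : ℝ) ^ (1 - 2 / p) := by
    rw [← Real.rpow_natCast, ← Real.rpow_mul hd0.le]
    nth_rewrite 1 [← Real.rpow_one (d : ℝ)]
    rw [← Real.rpow_add hd0]
    congr 1
    push_cast; ring
  rw [h5, ← Real.rpow_le_rpow_iff (z := p / 2) (by positivity) (by positivity) (by linarith),
    ← Real.rpow_mul hd0.le]
  refine h4.trans (le_of_eq ?_)
  congr 1
  have : p ≠ 0 := by linarith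
  field_simp

/-- By Hölder ‖θ‖₁^p ≤ d^(p-1), and the upper limit on p is exactly what keeps d^(p-1) ≤ e ≤ 3. -/
theorem sum_abs_le_three (hp : 1 ≤ p) (hp' : p ≤ 1 + 1 / (1 + Real.log d)) (hd : 1 ≤ d)
    {θ : EuclideanSpace ℝ (Fin d)} (hθ : ∑ i, |θ i| ^ p ≤ 1) : ∑ i, |θ i| ≤ 3 := by
  have hd1 : (1 : ℝ) ≤ d := by exact_mod_cast hd
  have hlog := Real.log_nonneg hd1
  have h1 := Real.rpow_sum_le_const_mul_sum_rpow (Finset.univ : Finset (Fin d)) (fun i => θ i) hp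
  rw [Finset.card_univ, Fintype.card_fin] at h1
  have h2 : (d : ℝ) ^ (p - 1) ≤ 3 := by
    rw [Real.rpow_def_of_pos (by linarith)]
    have h3 : Real.log d * (p - 1) ≤ 1 := by
      have h4 : (p - 1) * (1 + Real.log d) ≤ 1 := by
        rw [← le_div_iff₀ (by positivity)]; linarith
      nlinarith
    exact (Real.exp_le_exp.2 h3).trans (by linarith [Real.exp_one_lt_d9])
  have h5 : (∑ i, |θ i|) ^ p ≤ 3 :=
    h1.trans ((mul_le_of_le_one_right (by positivity) hθ).trans h2)
  by_contra! h6
  have := Real.self_le_rpow_of_one_le (by linarith : 1 ≤ ∑ i, |θ i|) hp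
  linarith

end Balls

/-- Since log y ≥ log 2 > 1/2, the 1 is absorbed by 2 log y. This converts the 1 + log of the upper
bounds into the log(1 + m) of the lower bounds. -/
theorem one_add_log_le {x y : ℝ} (hx : 0 < x) (hxy : x ≤ y) (hy : 2 ≤ y) :
    1 + Real.log x ≤ 3 * Real.log y := by
  have h1 := Real.log_le_log hx hxy
  have h2 := Real.log_le_log two_pos hy
  linarith [Real.log_two_gt_d9]

/-! ### Matching the bounds in each regime -/

section Regimes

variable {d : ℕ} {Θ : Set (EuclideanSpace ℝ (Fin d))} {σ : ℝ}

/-- The parametric regime: `Θ` contains a cube of side `σ`. -/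
theorem mleOrderOptimal_of_cube (hd : 1 ≤ d) (hσ : 0 < σ) (hΘ : ∀ θ, (∀ i, |θ i| ≤ σ) → θ ∈ Θ) :
    MLEOrderOptimal 1000000 Θ σ := by
  have hd0 : (0 : ℝ) < d := by exact_mod_cast hd
  refine mleOrderOptimal_of_bounds (U := 128 * (d * σ ^ 2)) (V := d * ((σ / 2) ^ 2 / 32)) hσ
    (by positivity) ?_ (fun proj hp => hp.worstCaseRisk_le_dim hσ)
    (le_minimaxRisk (m := 1) hσ le_rfl (mul_one d).le ?_ fun θ hθ _ => hΘ θ fun i => ?_)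
  · have : 0 ≤ (d : ℝ) * σ ^ 2 := by positivity
    push_cast
    nlinarith
  · norm_num
    nlinarith [Real.log_two_gt_d9, sq_nonneg σ]
  · rcases hθ i with h | h <;> rw [h]
    · simpa using hσ.le
    · rw [abs_of_pos (by positivity)]; linarith

/-- `Θ` is comparable to a cube whose side is at most `σ`. -/
theorem mleOrderOptimal_of_small_cube (hd : 1 ≤ d) {r : ℝ} (hr : 0 < r) (hrσ : r ≤ σ)
    (hΘ : ∀ θ, (∀ i, |θ i| ≤ r) → θ ∈ Θ) (hR : ∀ θ ∈ Θ, ‖θ‖ ^ 2 ≤ d * r ^ 2) :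
    MLEOrderOptimal 1000000 Θ σ := by
  have hd0 : (0 : ℝ) < d := by exact_mod_cast hd
  have hσ := hr.trans_le hrσ
  refine mleOrderOptimal_of_bounds (U := 4 * (d * r ^ 2)) (V := d * ((r / 2) ^ 2 / 32)) hσ
    (by positivity) ?_ (fun proj hp => hp.worstCaseRisk_le_diam hR)
    (le_minimaxRisk (m := 1) hσ le_rfl (mul_one d).le ?_ fun θ hθ _ => hΘ θ fun i => ?_)
  · have : 0 ≤ (d : ℝ) * r ^ 2 := by positivity
    push_cast
    nlinarith
  · norm_num
    have : r ^ 2 ≤ σ ^ 2 := by gcongr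
    nlinarith [Real.log_two_gt_d9, sq_nonneg σ]
  · rcases hθ i with h | h <;> rw [h]
    · simpa using hr.le
    · rw [abs_of_pos (by positivity)]; linarith

/-- The high-noise regime, where the risk is of the order of the squared radius. -/
theorem mleOrderOptimal_of_large_noise (hd : 1 ≤ d) (hσ : 0 < σ)
    (hlog : 1 / 3 ≤ σ ^ 2 * Real.log (1 + d))
    (hΘ : ∀ θ : EuclideanSpace ℝ (Fin d), ∀ a, |a| ≤ 1 → (∀ i, θ i = 0 ∨ θ i = a) →
      (Finset.univ.filter fun i => θ i ≠ 0).card ≤ 1 → θ ∈ Θ)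
    (hR : ∀ θ ∈ Θ, ‖θ‖ ^ 2 ≤ 1) : MLEOrderOptimal 1000000 Θ σ := by
  refine mleOrderOptimal_of_bounds (U := 4 * 1) (V := (1 : ℕ) * ((1 / 3) ^ 2 / 32)) hσ
    (by norm_num) (by norm_num) (fun proj hp => hp.worstCaseRisk_le_diam hR)
    (le_minimaxRisk (m := d) hσ hd (one_mul d).le ?_ fun θ hθ hc => hΘ θ (1 / 3) ?_ hθ hc)
  · linarith
  · rw [abs_of_pos] <;> norm_num

theorem IsProjection.worstCaseRisk_le_of_log
    {proj : EuclideanSpace ℝ (Fin d) → EuclideanSpace ℝ (Fin d)} (h : IsProjection Θ proj)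
    {L B : ℝ} (hσ : 0 < σ) (hL : 1 ≤ L) (hB0 : 0 ≤ B)
    (hB : ∀ θ ∈ Θ, ∀ v ∈ Θ, ∑ i, 2 * (2 * (σ * √L)) * |v i - θ i| ≤ ‖v - θ‖ ^ 2 / 2 + B) :
    worstCaseRisk Θ σ proj ≤ ENNReal.ofReal (4 * B + 64 * (d * σ ^ 2 * Real.exp (-L))) := by
  have hs : 1 ≤ √L := Real.one_le_sqrt.2 hL
  -- l = t minimizes l²/2 - lt, and the minimum is -2L ≤ -L.
  refine (h.worstCaseRisk_le (t := 2 * √L) (l := 2 * √L) hσ (by linarith) hB0 ?_).trans ?_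
  · rwa [← mul_left_comm 2 σ]
  · refine ENNReal.ofReal_le_ofReal ?_
    have h1 : (2 * √L) ^ 2 / 2 - 2 * √L * (2 * √L) ≤ -L := by
      have := Real.sq_sqrt (zero_le_one.trans hL)
      nlinarith
    calc 4 * B + d * (64 * σ ^ 2 * Real.exp ((2 * √L) ^ 2 / 2 - 2 * √L * (2 * √L)))
        ≤ 4 * B + d * (64 * σ ^ 2 * Real.exp (-L)) := by gcongr
      _ = _ := by ring

theorem mleOrderOptimal_sparseBall {s : ℕ} (hs : 1 ≤ s) (hsd : s ≤ d) (hσ : 0 < σ) :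
    MLEOrderOptimal 1000000 (sparseBall d s) σ := by
  have hs0 : (0 : ℝ) < s := by exact_mod_cast hs
  have hd0 : (0 : ℝ) < d := by exact_mod_cast hs.trans hsd
  have hsd' : (s : ℝ) ≤ d := by exact_mod_cast hsd
  -- This L makes d exp(-L) ≤ s, so the excess term is at most of order sσ²L.
  set L := 1 + Real.log (d / s) with hL
  have hL1 : 1 ≤ L := by
    have := Real.log_nonneg ((one_le_div hs0).2 hsd')
    linarith
  have hm1 : 1 ≤ d / s := Nat.div_pos hsd hs
  have hm : L ≤ 3 * Real.log (1 + (d / s : ℕ)) := by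
    refine one_add_log_le (by positivity) ?_ ?_
    · have := Nat.lt_floor_add_one ((d : ℝ) / s)
      rw [Nat.floor_div_eq_div] at this
      linarith
    · have : (1 : ℝ) ≤ (d / s : ℕ) := by exact_mod_cast hm1
      linarith
  have hsq : √L ^ 2 = L := Real.sq_sqrt (by linarith)
  -- The lower bound uses s blocks of ⌊d/s⌋ coordinates. Height σ√L/3 is admissible because L ≤ 3
  -- log(1 + m) gives L/9 ≤ log(1 + m)/2.
  refine mleOrderOptimal_of_bounds (U := 128 * (s * (σ ^ 2 * L)))
    (V := s * ((σ * √L / 3) ^ 2 / 32)) hσ (by positivity) ?_ (fun proj hp => ?_)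
    (le_minimaxRisk hσ hm1 (Nat.mul_div_le d s) ?_ fun θ _ hc => hc)
  · have : 0 ≤ (s : ℝ) * (σ ^ 2 * L) := by positivity
    rw [div_pow, mul_pow, hsq]
    push_cast
    nlinarith
  · refine (hp.worstCaseRisk_le_of_log (B := 16 * (s * (σ ^ 2 * L))) hσ hL1 (by positivity)
      ?_).trans (ENNReal.ofReal_le_ofReal ?_)
    · intro θ hθ v hv
      have hcard : (Finset.univ.filter fun i => v i - θ i ≠ 0).card ≤ 2 * s := by
        refine (Finset.card_le_card (t := (Finset.univ.filter fun i => v i ≠ 0) ∪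
          Finset.univ.filter fun i => θ i ≠ 0) fun i hi => ?_).trans
          ((Finset.card_union_le _ _).trans ?_)
        · simp only [Finset.mem_union, Finset.mem_filter, Finset.mem_univ, true_and] at hi ⊢
          by_contra! h
          exact hi (by rw [h.1, h.2, sub_zero])
        · have h1 : (Finset.univ.filter fun i => v i ≠ 0).card ≤ s := hv
          have h2 : (Finset.univ.filter fun i => θ i ≠ 0).card ≤ s := hθ
          linarith
      have hpt : ∀ i, 2 * (2 * (σ * √L)) * |v i - θ i| ≤
          (v i - θ i) ^ 2 / 2 + if v i - θ i ≠ 0 then 8 * (σ ^ 2 * L) else 0 := by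
        intro i
        split_ifs with h
        · rw [← sq_abs (v i - θ i)]
          have : σ ^ 2 * L = (σ * √L) ^ 2 := by rw [mul_pow, hsq]
          rw [this]
          nlinarith [sq_nonneg (|v i - θ i| - 4 * (σ * √L))]
        · simp [not_not.1 h]
      refine (Finset.sum_le_sum fun i _ => hpt i).trans ?_
      rw [Finset.sum_add_distrib, ← Finset.sum_div, ← Finset.sum_filter, Finset.sum_const,
        nsmul_eq_mul, EuclideanSpace.real_norm_sq_eq]
      have hcard' : ((Finset.univ.filter fun i => v i - θ i ≠ 0).card : ℝ) ≤ 2 * s := by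
        exact_mod_cast hcard
      have h3 : 0 ≤ 8 * (σ ^ 2 * L) := by positivity
      have h4 := mul_le_mul_of_nonneg_right hcard' h3
      simp only [PiLp.sub_apply]
      linarith
    · have h1 : d * σ ^ 2 * Real.exp (-L) ≤ s * (σ ^ 2 * L) := by
        have h2 : Real.exp (-L) ≤ s / d := by
          rw [hL, neg_add, Real.exp_add, Real.exp_neg (Real.log _), Real.exp_log (by positivity),
            inv_div]
          exact mul_le_of_le_one_left (by positivity) (Real.exp_le_one_iff.2 (by norm_num))
        calc d * σ ^ 2 * Real.exp (-L) ≤ d * σ ^ 2 * (s / d) := by gcongr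
          _ = s * (σ ^ 2 * 1) := by field_simp
          _ ≤ _ := by gcongr
      linarith
  · rw [div_pow, mul_pow, hsq]
    have := mul_le_mul_of_nonneg_left hm (sq_nonneg σ)
    nlinarith [sq_nonneg σ]

/-- For u ≥ 4τ the quadratic term dominates; for u ≤ 4τ, u = u^(1-q) u^q with u^(1-q) ≤ 4τ^(1-q).
Summed over coordinates, it absorbs the linear term using only the ℓ_q sum. -/
theorem two_mul_mul_le_rpow {q u τ : ℝ} (hq0 : 0 < q) (hq : q ≤ 1) (hu : 0 ≤ u) (hτ : 0 < τ) :
    2 * τ * u ≤ u ^ 2 / 2 + 8 * τ ^ (2 - q) * u ^ q := by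
  rcases le_total (4 * τ) u with h | h
  · have : 0 ≤ 8 * τ ^ (2 - q) * u ^ q := by positivity
    nlinarith
  · have h1 : u = u ^ (1 - q) * u ^ q := by
      rw [← Real.rpow_add' hu (by norm_num)]
      norm_num
    have h2 : u ^ (1 - q) ≤ 4 * τ ^ (1 - q) := by
      calc u ^ (1 - q) ≤ (4 * τ) ^ (1 - q) := Real.rpow_le_rpow hu h (by linarith)
        _ = 4 ^ (1 - q) * τ ^ (1 - q) := Real.mul_rpow (by norm_num) hτ.le
        _ ≤ 4 ^ (1 : ℝ) * τ ^ (1 - q) := by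
            gcongr
            · norm_num
            · linarith
        _ = _ := by rw [Real.rpow_one]
    have h3 : τ ^ (2 - q) = τ * τ ^ (1 - q) := by
      rw [← Real.rpow_one_add' hτ.le (by linarith)]
      congr 1; ring
    calc 2 * τ * u = 2 * τ * (u ^ (1 - q) * u ^ q) := by rw [← h1]
      _ ≤ 2 * τ * (4 * τ ^ (1 - q) * u ^ q) := by gcongr
      _ = 8 * τ ^ (2 - q) * u ^ q := by rw [h3]; ring
      _ ≤ _ := by linarith [sq_nonneg u]

/-- Sets comparable to an `ℓ_q` ball with `q ≤ 1`. -/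
theorem mleOrderOptimal_of_lq_ball {q : ℝ} (hq0 : 0 < q) (hq : q ≤ 1) (hd : 1 ≤ d) (hσ : 0 < σ)
    (hΘ : ∀ θ : EuclideanSpace ℝ (Fin d), ∑ i, |θ i| ^ q ≤ 1 → θ ∈ Θ)
    (hΘ' : ∀ θ ∈ Θ, ∑ i, |θ i| ^ q ≤ 3) (hR : ∀ θ ∈ Θ, ‖θ‖ ^ 2 ≤ 1) :
    MLEOrderOptimal 1000000 Θ σ := by
  have hd0 : (0 : ℝ) < d := by exact_mod_cast hd
  have hd1 : (1 : ℝ) ≤ d := by exact_mod_cast hd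
  rcases le_total (d * σ ^ q) 1 with hx | hx
  · exact mleOrderOptimal_of_cube hd hσ fun θ hθ =>
      hΘ θ ((sum_abs_rpow_le_of_abs_le hq0 hθ).trans hx)
  set L := 1 + Real.log (d * σ ^ q) with hL
  have hL1 : 1 ≤ L := by linarith [Real.log_nonneg hx]
  have hsq : √L ^ 2 = L := Real.sq_sqrt (by linarith)
  have hsL : 1 ≤ √L := Real.one_le_sqrt.2 hL1
  rcases le_total 1 (σ ^ 2 * L) with hbig | hsmall
  · refine mleOrderOptimal_of_large_noise hd hσ ?_ (fun θ a ha hθ hc => hΘ θ ?_) hR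
    -- For σ ≥ 1 the bound log 2 > 1/3 is enough; for σ ≤ 1, dσ^q ≤ d and hence L ≤ 3 log(1 + d).
    · rcases le_total 1 σ with h1 | h1
      · have h2 := Real.log_le_log two_pos (by linarith : (2 : ℝ) ≤ 1 + d)
        nlinarith [Real.log_two_gt_d9]
      · have h2 : d * σ ^ q ≤ 1 + d := by
          have := Real.rpow_le_one hσ.le h1 hq0.le
          nlinarith
        have h3 := one_add_log_le (by positivity) h2 (by linarith)
        have h4 := mul_le_mul_of_nonneg_left h3 (sq_nonneg σ)
        linarith
    · refine (sum_abs_rpow_le_of_card_le hq0 hθ hc).trans ?_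
      rw [Nat.cast_one, one_mul]
      exact Real.rpow_le_one (abs_nonneg _) ha hq0.le
  · set ρ := σ * √L with hρ
    have hρ0 : 0 < ρ := by positivity
    have hρ2 : ρ ^ 2 = σ ^ 2 * L := by rw [hρ, mul_pow, hsq]
    have hρ1 : ρ ≤ 1 := by
      rw [← hρ2] at hsmall
      exact (sq_le_one_iff₀ hρ0.le).1 hsmall
    have hσρ : σ ≤ ρ := le_mul_of_one_le_right hσ.le hsL
    have hρq : 1 ≤ ρ ^ (-q) := Real.one_le_rpow_of_pos_of_le_one_of_nonpos hρ0 hρ1 (by linarith)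
    have hρqq : ρ ^ (-q) * ρ ^ q = 1 := by rw [← Real.rpow_add hρ0]; simp
    -- As many spikes of height ρ as the unit ℓ_q ball can hold; since ρ ≤ 1, rounding down loses at
    -- most a factor 2.
    set n := ⌊ρ ^ (-q)⌋₊ with hn
    have hn1 : 1 ≤ n := Nat.one_le_floor_iff _ |>.2 hρq
    have hn0 : (0 : ℝ) < n := by exact_mod_cast hn1
    have hnle : (n : ℝ) ≤ ρ ^ (-q) := Nat.floor_le (by positivity)
    have hnge : ρ ^ (-q) ≤ 2 * n := by
      have h1 := Nat.lt_floor_add_one (ρ ^ (-q))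
      have h2 : (1 : ℝ) ≤ n := by exact_mod_cast hn1
      linarith
    have hσq : σ ^ q ≤ ρ ^ q := Real.rpow_le_rpow hσ.le hσρ hq0.le
    -- Since σ ≤ ρ, this gives dσ^q ≤ d/n: blocks of ⌊d/n⌋ coordinates are long enough for log(1 +
    -- ⌊d/n⌋) to be of order at least L.
    have hnd' : n * (d * σ ^ q) ≤ d := by
      calc n * (d * σ ^ q) ≤ ρ ^ (-q) * (d * ρ ^ q) := by gcongr
        _ = d := by rw [mul_left_comm, hρqq, mul_one]
    have hnd : n ≤ d := by
      have : (n : ℝ) ≤ d := (le_mul_of_one_le_right hn0.le hx).trans hnd'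
      exact_mod_cast this
    have hm1 : 1 ≤ d / n := Nat.div_pos hnd hn1
    have hm : L ≤ 3 * Real.log (1 + (d / n : ℕ)) := by
      refine one_add_log_le (by positivity) ?_ ?_
      · have h1 := Nat.lt_floor_add_one ((d : ℝ) / n)
        rw [Nat.floor_div_eq_div] at h1
        have h2 : d * σ ^ q ≤ (d : ℝ) / n := by
          rw [le_div_iff₀ hn0]; linarith
        linarith
      · have : (1 : ℝ) ≤ (d / n : ℕ) := by exact_mod_cast hm1
        linarith
    have hρpow : ρ ^ (2 - q) = ρ ^ 2 * ρ ^ (-q) := by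
      rw [← Real.rpow_natCast, ← Real.rpow_add hρ0]; norm_num; rfl
    refine mleOrderOptimal_of_bounds (U := 832 * ρ ^ (2 - q)) (V := n * ((ρ / 3) ^ 2 / 32)) hσ
      (by positivity) ?_ (fun proj hp => ?_)
      (le_minimaxRisk hσ hm1 (Nat.mul_div_le d n) ?_ fun θ hθ hc => hΘ θ ?_)
    · rw [hρpow]
      have h1 := mul_le_mul_of_nonneg_left hnge (sq_nonneg ρ)
      have h2 : 0 ≤ ρ ^ 2 * n := by positivity
      push_cast
      nlinarith
    · refine (hp.worstCaseRisk_le_of_log (B := 192 * ρ ^ (2 - q)) hσ hL1 (by positivity)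
        ?_).trans (ENNReal.ofReal_le_ofReal ?_)
      · intro θ hθ v hv
        rw [← hρ]
        have hτ : (2 * ρ) ^ (2 - q) ≤ 4 * ρ ^ (2 - q) := by
          rw [Real.mul_rpow two_pos.le hρ0.le]
          gcongr
          calc (2 : ℝ) ^ (2 - q) ≤ 2 ^ (2 : ℝ) :=
                Real.rpow_le_rpow_of_exponent_le (by norm_num) (by linarith)
            _ = 4 := by norm_num
        -- For q ≤ 1 the map u ↦ u^q is subadditive, so differences of points of Θ have ℓ_q sum at
        -- most 3 + 3.
        have hsum : ∑ i, |v i - θ i| ^ q ≤ 6 := by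
          calc ∑ i, |v i - θ i| ^ q ≤ ∑ i, (|v i| ^ q + |θ i| ^ q) := by
                refine Finset.sum_le_sum fun i _ => ?_
                exact (Real.rpow_le_rpow (abs_nonneg _) (abs_sub _ _) hq0.le).trans
                  (Real.rpow_add_le_add_rpow (abs_nonneg _) (abs_nonneg _) hq0.le hq)
            _ ≤ 6 := by
                rw [Finset.sum_add_distrib]
                linarith [hΘ' θ hθ, hΘ' v hv]
        have hpt := Finset.sum_le_sum fun i (_ : i ∈ Finset.univ) =>
          two_mul_mul_le_rpow hq0 hq (abs_nonneg (v i - θ i)) (by positivity : 0 < 2 * ρ)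
        refine hpt.trans ?_
        rw [Finset.sum_add_distrib, ← Finset.sum_div, ← Finset.mul_sum,
          EuclideanSpace.real_norm_sq_eq]
        simp only [sq_abs, PiLp.sub_apply]
        have hs0 : 0 ≤ ∑ i, |v i - θ i| ^ q := Finset.sum_nonneg fun _ _ => by positivity
        have hρp : 0 ≤ ρ ^ (2 - q) := by positivity
        nlinarith [mul_le_mul hτ hsum hs0 (by positivity : 0 ≤ 4 * ρ ^ (2 - q))]
      · have h1 : d * σ ^ 2 * Real.exp (-L) ≤ ρ ^ (2 - q) := by
          have h2 : Real.exp (-L) ≤ (d * σ ^ q)⁻¹ := by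
            rw [hL, neg_add, Real.exp_add, Real.exp_neg (Real.log _), Real.exp_log (by positivity)]
            exact mul_le_of_le_one_left (by positivity) (Real.exp_le_one_iff.2 (by norm_num))
          calc d * σ ^ 2 * Real.exp (-L) ≤ d * σ ^ 2 * (d * σ ^ q)⁻¹ := by gcongr
            _ = σ ^ 2 / σ ^ q := by field_simp
            _ = σ ^ (2 - q) := by rw [Real.rpow_sub hσ, Real.rpow_two]
            _ ≤ _ := Real.rpow_le_rpow hσ.le hσρ (by linarith)
        linarith
    · rw [div_pow, hρ2]
      have := mul_le_mul_of_nonneg_left hm (sq_nonneg σ)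
      nlinarith [sq_nonneg σ]
    · refine (sum_abs_rpow_le_of_card_le hq0 hθ hc).trans ?_
      calc n * |ρ / 3| ^ q ≤ ρ ^ (-q) * ρ ^ q := by
            rw [abs_of_pos (by positivity)]
            gcongr
            linarith
        _ = 1 := hρqq

end Regimes

/-! ### The ℓ_p balls, case by case -/

theorem mleOrderOptimal_lpBall_of_two_le {d : ℕ} {p : ℝ≥0∞} {σ : ℝ} (hd : 1 ≤ d) (hσ : 0 < σ)
    (hp : 2 ≤ p) : MLEOrderOptimal 1000000 (lpBall d p) σ := by
  have hd0 : (0 : ℝ) < d := by exact_mod_cast hd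
  -- r = d^(-1/p), or 1 for p = ∞, is the half-side of the inscribed cube; for p ≥ 2 its corners
  -- have the largest Euclidean norm in the ball.
  obtain ⟨r, hr, h1, h2⟩ : ∃ r : ℝ, 0 < r ∧
      (∀ θ : EuclideanSpace ℝ (Fin d), (∀ i, |θ i| ≤ r) → θ ∈ lpBall d p) ∧
      ∀ θ ∈ lpBall d p, ‖θ‖ ^ 2 ≤ d * r ^ 2 := by
    rcases eq_or_ne p ∞ with rfl | hpt
    · refine ⟨1, one_pos, fun θ hθ => (mem_lpBall_top θ).2 hθ, fun θ hθ => ?_⟩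
      have h := sum_abs_rpow_le_of_abs_le two_pos ((mem_lpBall_top θ).1 hθ)
      rw [EuclideanSpace.real_norm_sq_eq]
      simpa using h
    · obtain ⟨p, rfl⟩ : ∃ p' : ℝ, p = ENNReal.ofReal p' := ⟨_, (ENNReal.ofReal_toReal hpt).symm⟩
      have hp2 : 2 ≤ p := by
        have : ENNReal.ofReal 2 ≤ ENNReal.ofReal p := by simpa using hp
        by_contra! h
        exact absurd this (not_le.2 ((ENNReal.ofReal_lt_ofReal_iff two_pos).2 h))
      have hp0 : 0 < p := by linarith
      refine ⟨(d : ℝ) ^ (-(1 / p)), by positivity, fun θ hθ => (mem_lpBall_ofReal hp0 θ).2 ?_,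
        fun θ hθ => norm_sq_le_of_sum_abs_rpow_le hp2 hd ((mem_lpBall_ofReal hp0 θ).1 hθ)⟩
      refine (sum_abs_rpow_le_of_abs_le hp0 hθ).trans (le_of_eq ?_)
      rw [← Real.rpow_mul hd0.le, neg_mul, one_div_mul_cancel hp0.ne', Real.rpow_neg_one,
        mul_inv_cancel₀ hd0.ne']
  rcases le_total σ r with h | h
  · exact mleOrderOptimal_of_cube hd hσ fun θ hθ => h1 θ fun i => (hθ i).trans h
  · exact mleOrderOptimal_of_small_cube hd hr h h1 h2

theorem mleOrderOptimal_lpBall_of_le {d : ℕ} {p σ : ℝ} (hd : 1 ≤ d) (hσ : 0 < σ) (hp0 : 0 < p)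
    (hp : p ≤ 1 + 1 / (1 + Real.log d)) :
    MLEOrderOptimal 1000000 (lpBall d (ENNReal.ofReal p)) σ := by
  have hd1 : (1 : ℝ) ≤ d := by exact_mod_cast hd
  have hlog := Real.log_nonneg hd1
  have hp2 : p ≤ 2 := by
    have : 1 / (1 + Real.log d) ≤ 1 := by
      rw [div_le_one (by positivity)]; linarith
    linarith
  have hR : ∀ θ ∈ lpBall d (ENNReal.ofReal p), ‖θ‖ ^ 2 ≤ 1 := fun θ hθ =>
    norm_sq_le_one_of_sum_abs_rpow_le hp0 hp2 ((mem_lpBall_ofReal hp0 θ).1 hθ)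
  rcases le_total p 1 with h1 | h1
  · refine mleOrderOptimal_of_lq_ball hp0 h1 hd hσ (fun θ => (mem_lpBall_ofReal hp0 θ).2)
      (fun θ hθ => ?_) hR
    linarith [(mem_lpBall_ofReal hp0 θ).1 hθ]
  · refine mleOrderOptimal_of_lq_ball one_pos le_rfl hd hσ (fun θ hθ => (mem_lpBall_ofReal hp0 θ).2
      (sum_abs_rpow_le_one_of_le one_pos h1 hθ)) (fun θ hθ => ?_) hR
    simpa using sum_abs_le_three h1 hp hd ((mem_lpBall_ofReal hp0 θ).1 hθ)

theorem mleOrderOptimal_lpBall_of_extreme_noise {d : ℕ} {p σ : ℝ} (hd : 1 ≤ d) (hσ : 0 < σ)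
    (hp0 : 0 < p) (hp2 : p < 2) (h : σ ≤ 1 / (d : ℝ) ^ (1 / p) ∨ 1 / √(1 + Real.log d) ≤ σ) :
    MLEOrderOptimal 1000000 (lpBall d (ENNReal.ofReal p)) σ := by
  have hd0 : (0 : ℝ) < d := by exact_mod_cast hd
  have hd1 : (1 : ℝ) ≤ d := by exact_mod_cast hd
  have hlog := Real.log_nonneg hd1
  rcases h with h | h
  · refine mleOrderOptimal_of_cube hd hσ fun θ hθ => (mem_lpBall_ofReal hp0 θ).2
      ((sum_abs_rpow_le_of_abs_le hp0 hθ).trans ?_)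
    have h1 := Real.rpow_le_rpow hσ.le h hp0.le
    rw [Real.div_rpow zero_le_one (by positivity), Real.one_rpow, ← Real.rpow_mul hd0.le,
      one_div_mul_cancel hp0.ne', Real.rpow_one, le_div_iff₀ hd0] at h1
    linarith
  · refine mleOrderOptimal_of_large_noise hd hσ ?_ (fun θ a ha hθ hc =>
      (mem_lpBall_ofReal hp0 θ).2 ((sum_abs_rpow_le_of_card_le hp0 hθ hc).trans ?_)) fun θ hθ =>
        norm_sq_le_one_of_sum_abs_rpow_le hp0 hp2.le ((mem_lpBall_ofReal hp0 θ).1 hθ)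
    · have h1 : 1 ≤ σ ^ 2 * (1 + Real.log d) := by
        rw [div_le_iff₀ (by positivity)] at h
        have h2 := pow_le_pow_left₀ zero_le_one h 2
        rwa [one_pow, mul_pow, Real.sq_sqrt (by positivity)] at h2
      have h2 := one_add_log_le hd0 (by linarith : (d : ℝ) ≤ 1 + d) (by linarith)
      have h3 := mul_le_mul_of_nonneg_left h2 (sq_nonneg σ)
      linarith
    · rw [Nat.cast_one, one_mul]
      exact Real.rpow_le_one (abs_nonneg _) ha hp0.le

end GaussianSequence

theorem theorem1 :
    ∃ C : ℝ≥0,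
      (∀ (d : ℕ) (p : ℝ≥0∞) (σ : ℝ), 1 ≤ d → 0 < σ → 2 ≤ p →
        MLEOrderOptimal C (lpBall d p) σ) ∧
      (∀ (d : ℕ) (p σ : ℝ), 1 ≤ d → 0 < σ → 0 < p → p ≤ 1 + 1 / (1 + Real.log d) →
        MLEOrderOptimal C (lpBall d (ENNReal.ofReal p)) σ) ∧
      (∀ (d : ℕ) (p σ : ℝ), 1 ≤ d → 0 < σ → 1 + 1 / (1 + Real.log d) < p → p < 2 →
        (σ ≤ 1 / (d : ℝ) ^ (1 / p) ∨ 1 / √(1 + Real.log d) ≤ σ) →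
        MLEOrderOptimal C (lpBall d (ENNReal.ofReal p)) σ) ∧
      (∀ (d s : ℕ) (σ : ℝ), 1 ≤ s → s ≤ d → 0 < σ →
        MLEOrderOptimal C (sparseBall d s) σ) := by
  -- The largest ratio produced is 832 · 2 · 288 = 479232, in `mleOrderOptimal_of_lq_ball`.
  refine ⟨1000000, fun d p σ hd hσ hp => mleOrderOptimal_lpBall_of_two_le hd hσ hp,
    fun d p σ hd hσ hp0 hp => mleOrderOptimal_lpBall_of_le hd hσ hp0 hp,
    fun d p σ hd hσ hp hp2 h => mleOrderOptimal_lpBall_of_extreme_noise hd hσ ?_ hp2 h,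
    fun d s σ hs hsd hσ => mleOrderOptimal_sparseBall hs hsd hσ⟩
  have hlog := Real.log_nonneg (by exact_mod_cast hd : (1 : ℝ) ≤ d)
  have : 0 < 1 / (1 + Real.log d) := by positivity
  linarith
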